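/- Let $E=(E^0,E^1,r,s)$ be a topological graph: $E^0,E^1$ are locally compact Hausdorff spaces, $r:E^1\to E^0$ is continuous and $s:E^1\to E^0$ is a local homeomorphism. **Representations of $E$.** For $f\in C_0(E^0)$, $x\in C_c(E^1)$ put $(f\cdot x)(e)=f(r(e))x(e)$ and $(x\cdot f)(e)=x(e)f(s(e))$. An $s$-section is a set $U\subset E^1$ such that $s|_U$ is a homeomorphism onto its image; write $\operatorname{osupp}(x)=\{e: x(e)\neq 0\}$ and $\operatorname{supp}(x)=\overline{\operatorname{osupp}(x)}$. If $\operatorname{osupp}(x)$ is an $s$-section, let $\widehat x(s(e))=|x(e)|^2$ for $e\in\operatorname{osupp}(x)$ and $\widehat x=0$ off $s(\operatorname{osupp}(x))$. A *Toeplitz representation* of $E$ in a $C^*$-algebra $B$ is a pair $(\psi,\pi)$ of a linear map $\psi:C_c(E^1)\to B$ and a $*$-homomorphism $\pi:C_0(E^0)\to B$ such that (1) $\psi(f\cdot x)=\pi(f)\psi(x)$; (2) $\pi(\widehat x)=\psi(x)^*\psi(x)$ if $\operatorname{supp}(x)$ is contained in an open $s$-section; (3) $\psi(x)^*\psi(y)=0$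 if $\operatorname{supp}(x)$ and $\operatorname{supp}(y)$ are contained in disjoint open $s$-sections. Let $E^0_{\rm sce}=E^0\setminus\overline{r(E^1)}$, let $E^0_{\rm fin}$ be the set of $v\in E^0$ having a neighbourhood $N$ with $r^{-1}(N)$ compact, and $E^0_{\rm rg}=E^0_{\rm fin}\setminus\overline{E^0_{\rm sce}}$; regard $C_c(E^0_{\rm rg})$ and $C_0(E^0_{\rm rg})$ as subsets of $C_0(E^0)$ (extension by zero). A Toeplitz representation $(\psi,\pi)$ of $E$ is *covariant* if there is a set $\mathcal G\subset C_c(E^0_{\rm rg})$ of nonnegative functions generating $C_0(E^0_{\rm rg})$ as a $C^*$-algebra such that for each $f\in\mathcal G$ there are a finite cover $\mathcal N_f$ of $r^{-1}(\operatorname{supp} f)$ by open $s$-sections and nonnegative continuous functions $f_N$ $(N\in\mathcal N_f)$ on $E^1$ with $\operatorname{osupp}(f_N)\subset N\cap r^{-1}(\operatorname{supp} f)$, $\sum_{N}f_N=f\circ r$ and $\pi(f)=\sum_{N}\psi(\sqrt{f_N})\psi(\sqrt{f_N})^*$. A covariant Toeplitz representation $(\psi,\pi)$ of $E$ in $B$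 is *universal* if for every covariant Toeplitz representation $(\psi',\pi')$ of $E$ in a $C^*$-algebra $D$ there is a $*$-homomorphism $h:B\to D$ with $h\circ\psi=\psi'$ and $h\circ\pi=\pi'$. **The algebra $\mathcal O(E)$.** Let $X(E)$ be the $C^*$-correspondence over $C_0(E^0)$ obtained by completing $C_c(E^1)$, with the above actions and the inner product $\langle x,y\rangle(v)=\sum_{s(e)=v}\overline{x(e)}y(e)$, in the norm $\|\langle x,x\rangle\|^{1/2}$; let $\phi$ be its left action, $\Theta_{x,y}(z)=x\cdot\langle y,z\rangle$, and $\mathcal K(X(E))$ the closed span of the $\Theta_{x,y}$. A Toeplitz representation of $X(E)$ in $B$ is a pair $(\psi,\pi)$ of a linear map $\psi:X(E)\to B$ and a $*$-homomorphism $\pi:C_0(E^0)\to B$ with $\psi(a\cdot x)=\pi(a)\psi(x)$ and $\psi(x)^*\psi(y)=\pi(\langle x,y\rangle)$; it is covariant if $\psi^{(1)}(\phi(a))=\pi(a)$ for all $a\in\phi^{-1}(\mathcal K(X(E)))\cap(\ker\phi)^\perp$, where $\psi^{(1)}:\mathcal K(X(E))\to B$ is the $*$-homomorphism with $\psi^{(1)}(\Theta_{x,y})=\psi(x)\psi(y)^*$.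 Universality is defined as above, and $\mathcal O(E)=\mathcal O_{X(E)}$ is the $C^*$-algebra, unique up to canonical isomorphism, generated by a universal covariant Toeplitz representation $(j_X,j_A)$ of $X(E)$. **Theorem.** The $C^*$-algebra $\mathcal O(E)$ exists, and $(j_1,j_0)=(j_X|_{C_c(E^1)},j_A)$ is a universal covariant Toeplitz representation of $E$ which generates $\mathcal O(E)$. Moreover, the $C^*$-algebra generated by the image of any universal covariant Toeplitz representation of $E$ is isomorphic to $\mathcal O(E)$. -/

import Mathlib

set_option linter.unusedSectionVars false

open scoped CompactlySupported ZeroAtInfty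


universe u v w

noncomputable section

/-! ### C⋆-correspondences and their covariant Toeplitz representations -/

/-- The C⋆-subalgebra of `B` generated by the ranges of two maps `ψ` and `π`. -/
def generatedCStarAlgebra {X A B : Type*} [NonUnitalCStarAlgebra B] (ψ : X → B) (π : A → B) :
    NonUnitalStarSubalgebra ℂ B :=
  (NonUnitalStarAlgebra.adjoin ℂ (Set.range ψ ∪ Set.range π)).topologicalClosure

/-- A C⋆-correspondence over `A`, on a Banach space `X`: a right Hilbert `A`-module whose norm is
that of `X`, with a left action of `A` by adjointable operators. The inner product is conjugate
linear in the first variable. The continuity of the inner product and of the actions, which is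
part of the data here, is automatic in a right Hilbert module. -/
structure CStarCorrespondence (A X : Type*) [NonUnitalCStarAlgebra A] [NormedAddCommGroup X]
    [NormedSpace ℂ X] [CompleteSpace X] where
  /-- the inner product `⟨x, y⟩` -/
  inner : X →L⋆[ℂ] X →L[ℂ] A
  /-- the right action; `ract x a` is `x · a` -/
  ract : X →L[ℂ] A →L[ℂ] X
  /-- the left action as a homomorphism; `lact a x` is `a · x` -/
  lact : A →ₙₐ[ℂ] (X →L[ℂ] X)
  ract_mul : ∀ x a b, ract x (a * b) = ract (ract x a) b
  inner_ract : ∀ x y a, inner x (ract y a) = inner x y * a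
  star_inner : ∀ x y, star (inner x y) = inner y x
  inner_self_nonneg : ∀ x, ∃ b, inner x x = star b * b
  norm_sq_eq : ∀ x, ‖x‖ ^ 2 = ‖inner x x‖
  inner_lact : ∀ a x y, inner (lact (star a) y) x = inner y (lact a x)

namespace CStarCorrespondence

variable {A X : Type*} [NonUnitalCStarAlgebra A] [NormedAddCommGroup X] [NormedSpace ℂ X]
  [CompleteSpace X] (C : CStarCorrespondence A X)

/-- The rank one operator `Θ_{x,y} z = x · ⟨y, z⟩`. -/
def theta (x y : X) : X →L[ℂ] X := (C.ract x).comp (C.inner y)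

/-- `𝒦(X)`, the closed linear span of the rank one operators. -/
def compacts : Submodule ℂ (X →L[ℂ] X) :=
  (Submodule.span ℂ {T | ∃ x y, T = C.theta x y}).topologicalClosure

theorem theta_mem_compacts (x y : X) : C.theta x y ∈ C.compacts :=
  Submodule.le_topologicalClosure _ (Submodule.subset_span ⟨x, y, rfl⟩)

/-- The ideal `φ⁻¹(𝒦(X)) ∩ (ker φ)^⊥` of `A`, with `φ` the left action. -/
def katsuraIdeal : Set A :=
  {a | C.lact a ∈ C.compacts ∧ ∀ b, C.lact b = 0 → a * b = 0}

/-- Toeplitz representations of a C⋆-correspondence. -/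
structure IsToeplitzRep {B : Type*} [NonUnitalCStarAlgebra B] (ψ : X →ₗ[ℂ] B)
    (π : A →⋆ₙₐ[ℂ] B) : Prop where
  map_lact : ∀ a x, ψ (C.lact a x) = π a * ψ x
  star_mul : ∀ x y, star (ψ x) * ψ y = π (C.inner x y)

/-- `Ψ` is the homomorphism `ψ⁽¹⁾ : 𝒦(X) → B` determined by `ψ⁽¹⁾(Θ_{x,y}) = ψ(x) ψ(y)⋆`. -/
structure IsCompactsHom {B : Type*} [NonUnitalCStarAlgebra B] (ψ : X →ₗ[ℂ] B)
    (Ψ : C.compacts →L[ℂ] B) : Prop where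
  map_theta : ∀ x y, Ψ ⟨C.theta x y, C.theta_mem_compacts x y⟩ = ψ x * star (ψ y)
  map_mul : ∀ S T U : C.compacts, (U : X →L[ℂ] X) = (S : X →L[ℂ] X) * T → Ψ U = Ψ S * Ψ T
  map_star : ∀ S T : C.compacts, (∀ x y, C.inner (T.1 y) x = C.inner y (S.1 x)) →
    Ψ T = star (Ψ S)

/-- Covariant Toeplitz representations of a C⋆-correspondence, in Katsura's sense:
`ψ⁽¹⁾(φ(a)) = π(a)` for all `a ∈ φ⁻¹(𝒦(X)) ∩ (ker φ)^⊥`. -/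
structure IsCovariantRep {B : Type*} [NonUnitalCStarAlgebra B] (ψ : X →ₗ[ℂ] B)
    (π : A →⋆ₙₐ[ℂ] B) : Prop extends C.IsToeplitzRep ψ π where
  covariant : ∃ Ψ : C.compacts →L[ℂ] B, C.IsCompactsHom ψ Ψ ∧
    ∀ (a : A) (ha : a ∈ C.katsuraIdeal), Ψ ⟨C.lact a, ha.1⟩ = π a

/-- `B` is the C⋆-algebra `𝒪_X`, with `(ψ, π)` as its canonical representation: `(ψ, π)` is a
universal covariant Toeplitz representation of `X`, and it generates `B`. -/
structure IsCuntzPimsnerAlgebra {B : Type w} [NonUnitalCStarAlgebra B] (ψ : X →ₗ[ℂ] B)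
    (π : A →⋆ₙₐ[ℂ] B) : Prop extends C.IsCovariantRep ψ π where
  universal : ∀ (D : Type w) [NonUnitalCStarAlgebra D] (ψ' : X →ₗ[ℂ] D) (π' : A →⋆ₙₐ[ℂ] D),
    C.IsCovariantRep ψ' π' → ∃ h : B →⋆ₙₐ[ℂ] D, (∀ x, h (ψ x) = ψ' x) ∧ ∀ a, h (π a) = π' a
  generates : generatedCStarAlgebra ψ π = ⊤

end CStarCorrespondence

/-! ### Topological graphs -/

/-- A topological graph `(E⁰, E¹, r, s)` on the spaces `E⁰ = E₀` and `E¹ = E₁`; these are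
required to be locally compact and Hausdorff through type class arguments. -/
structure TopologicalGraph (E₀ E₁ : Type*) [TopologicalSpace E₀] [TopologicalSpace E₁] where
  r : E₁ → E₀
  s : E₁ → E₀
  continuous_r : Continuous r
  isLocalHomeomorph_s : IsLocalHomeomorph s

/-! ### Extension of maps to a completion -/

section Extension

open UniformSpace

variable {P F : Type*} [NormedAddCommGroup P] [NormedSpace ℂ P]

theorem completion_clm_ext [AddCommGroup F] [Module ℂ F] [TopologicalSpace F] [T2Space F]
    {σ : ℂ →+* ℂ} {S T : Completion P →SL[σ] F}
    (h : ∀ x : P, S (x : Completion P) = T (x : Completion P)) : S = T := by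
  ext1 z
  induction z using Completion.induction_on with
  | hp => exact isClosed_eq S.continuous T.continuous
  | ih z => exact h z

variable [NormedAddCommGroup F] [NormedSpace ℂ F] [CompleteSpace F] {σ : ℂ →+* ℂ}

/-- The continuous extension to the completion of a bounded semilinear map. -/
def extendToCompletion (f : P →ₛₗ[σ] F) : Completion P →SL[σ] F :=
  f.extendOfNorm (Completion.toComplL (𝕜 := ℂ) (E := P)).toLinearMap

theorem extendToCompletion_coe {f : P →ₛₗ[σ] F} {c : ℝ} (hf : ∀ x, ‖f x‖ ≤ c * ‖x‖) (x : P) :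
    extendToCompletion f (x : Completion P) = f x :=
  LinearMap.extendOfNorm_eq (e := (Completion.toComplL (𝕜 := ℂ) (E := P)).toLinearMap)
    Completion.denseRange_coe ⟨c, fun x => (hf x).trans_eq (by simp)⟩ x

theorem norm_extendToCompletion_le [RingHomIsometric σ] {f : P →ₛₗ[σ] F} {c : ℝ} (hc : 0 ≤ c)
    (hf : ∀ x, ‖f x‖ ≤ c * ‖x‖) : ‖extendToCompletion f‖ ≤ c :=
  LinearMap.opNorm_extendOfNorm_le (e := (Completion.toComplL (𝕜 := ℂ) (E := P)).toLinearMap)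
    Completion.denseRange_coe hc fun x => (hf x).trans_eq (by simp)

/-- A bounded sesquilinear map, extended to the completion in the second variable. -/
def sesqAux (b : P →ₗ⋆[ℂ] P →ₗ[ℂ] F) (hb : ∀ x y, ‖b x y‖ ≤ ‖x‖ * ‖y‖) :
    P →ₗ⋆[ℂ] Completion P →L[ℂ] F where
  toFun x := extendToCompletion (b x)
  map_add' x y := completion_clm_ext fun z => by
    rw [add_apply, extendToCompletion_coe (hb _), extendToCompletion_coe (hb _),
      extendToCompletion_coe (hb _), map_add, LinearMap.add_apply]
  map_smul' c x := completion_clm_ext fun z => by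
    rw [smul_apply, extendToCompletion_coe (hb _), extendToCompletion_coe (hb _), map_smulₛₗ,
      LinearMap.smul_apply]

/-- The continuous extension to the completion of a bounded sesquilinear map. -/
def sesqExtend (b : P →ₗ⋆[ℂ] P →ₗ[ℂ] F) (hb : ∀ x y, ‖b x y‖ ≤ ‖x‖ * ‖y‖) :
    Completion P →L⋆[ℂ] Completion P →L[ℂ] F :=
  extendToCompletion (sesqAux b hb)

theorem sesqExtend_coe (b : P →ₗ⋆[ℂ] P →ₗ[ℂ] F) (hb : ∀ x y, ‖b x y‖ ≤ ‖x‖ * ‖y‖) (x y : P) :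
    sesqExtend b hb (x : Completion P) (y : Completion P) = b x y := by
  have h : ∀ x, ‖sesqAux b hb x‖ ≤ 1 * ‖x‖ := fun x =>
    (norm_extendToCompletion_le (norm_nonneg x) (hb x)).trans_eq (one_mul _).symm
  rw [sesqExtend, extendToCompletion_coe h]
  exact extendToCompletion_coe (hb x) y

end Extension

namespace TopologicalGraph

variable {E₀ : Type u} {E₁ : Type v} [TopologicalSpace E₀] [TopologicalSpace E₁]
  [T2Space E₀] [T2Space E₁]
  (E : TopologicalGraph E₀ E₁)

section FiberSum

theorem continuous_s : Continuous E.s := E.isLocalHomeomorph_s.continuous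

theorem finite_fiber (F : C_c(E₁, ℂ)) (v : E₀) : (E.s ⁻¹' {v} ∩ tsupport F).Finite := by
  have hc : IsCompact (E.s ⁻¹' {v} ∩ tsupport F) :=
    F.hasCompactSupport'.inter_left (isClosed_singleton.preimage E.continuous_s)
  refine hc.finite ?_
  have h := E.isLocalHomeomorph_s.isLocallyInjective
  rw [isDiscrete_iff_forall_mem_exists_isOpen]
  intro e he
  obtain ⟨U, hU, heU, hinj⟩ := h e
  refine ⟨U, hU, ?_⟩
  ext e'
  constructor
  · rintro ⟨h1, h2, -⟩
    exact hinj h1 heU (by rw [h2, he.1])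
  · rintro rfl
    exact ⟨heU, he⟩

theorem finite_fiber_support (F : C_c(E₁, ℂ)) (v : E₀) :
    (E.s ⁻¹' {v} ∩ Function.support F).Finite :=
  (E.finite_fiber F v).subset (Set.inter_subset_inter_right _ (subset_tsupport F))

theorem continuous_fiberSum (F : C_c(E₁, ℂ)) :
    Continuous fun v => ∑ᶠ e ∈ E.s ⁻¹' {v}, F e := by
  classical
  rw [continuous_iff_continuousAt]
  intro v₀
  have hfin := E.finite_fiber F v₀
  set T := hfin.toFinset with hT
  have hTmem : ∀ e, e ∈ T ↔ E.s e = v₀ ∧ e ∈ tsupport F := fun e => by simp [hT]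
  obtain ⟨U, hU, hdisj⟩ := hfin.t2_separation
  let lh := fun e : E₁ => E.isLocalHomeomorph_s.localInverseAt e
  -- disjoint neighbourhoods on which `s` is invertible
  let W := fun e : E₁ => U e ∩ (lh e).target
  have hWo : ∀ e, IsOpen (W e) := fun e => (hU e).2.inter (lh e).open_target
  have hWe : ∀ e, e ∈ W e := fun e => ⟨(hU e).1, by simp [lh]⟩
  have hK : IsCompact (tsupport F \ ⋃ e ∈ T, W e) :=
    F.hasCompactSupport'.diff (isOpen_biUnion fun e _ => hWo e)
  have hKs : IsClosed (E.s '' (tsupport F \ ⋃ e ∈ T, W e)) :=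
    (hK.image E.continuous_s).isClosed
  have hv₀ : v₀ ∉ E.s '' (tsupport F \ ⋃ e ∈ T, W e) := by
    rintro ⟨e, ⟨h1, h2⟩, h3⟩
    exact h2 (Set.mem_biUnion (x := e) ((hTmem e).2 ⟨h3, h1⟩) (hWe e))
  have hloc : ∀ e ∈ T, ContinuousAt (lh e) v₀ ∧ lh e v₀ = e ∧ v₀ ∈ (lh e).source := by
    intro e he
    have hs : E.s e = v₀ := ((hTmem e).1 he).1
    have h1 : v₀ ∈ (lh e).source := by rw [← hs]; simp [lh]
    exact ⟨(lh e).continuousAt h1, by rw [← hs]; simp [lh], h1⟩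
  have hev : ∀ᶠ v in nhds v₀, (∑ᶠ e ∈ E.s ⁻¹' {v}, F e) = ∑ e ∈ T, F (lh e v) := by
    have h1 : ∀ᶠ v in nhds v₀, v ∉ E.s '' (tsupport F \ ⋃ e ∈ T, W e) :=
      hKs.isOpen_compl.mem_nhds hv₀
    have h2 : ∀ᶠ v in nhds v₀, ∀ e ∈ T, lh e v ∈ W e ∧ v ∈ (lh e).source := by
      rw [Filter.eventually_all_finset]
      intro e he
      obtain ⟨hc, hv, hs⟩ := hloc e he
      refine Filter.Eventually.and ?_ ((lh e).open_source.mem_nhds hs)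
      exact hc.eventually ((hWo e).mem_nhds (by rw [hv]; exact hWe e))
    filter_upwards [h1, h2] with v hv1 hv2
    have hsec : ∀ e ∈ T, E.s (lh e v) = v := fun e he =>
      E.isLocalHomeomorph_s.apply_localInverseAt_of_mem (hv2 e he).2
    have hinj : Set.InjOn (fun e => lh e v) (T : Set E₁) := by
      intro e he e' he' hee
      by_contra hne
      have hd := hdisj (by simpa [hT] using he) (by simpa [hT] using he') hne
      have hee' : lh e v = lh e' v := hee
      exact Set.disjoint_left.1 hd (hv2 e he).1.1 (by rw [hee']; exact (hv2 e' he').1.1)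
    rw [← Finset.sum_image (f := F) (g := fun e => lh e v) hinj]
    refine finsum_mem_eq_sum_of_inter_support_eq _ ?_
    ext e'
    simp only [Set.mem_inter_iff, Set.mem_preimage, Set.mem_singleton_iff, Finset.coe_image,
      Set.mem_image, Finset.mem_coe]
    constructor
    · rintro ⟨hs, hF⟩
      refine ⟨?_, hF⟩
      have : e' ∈ ⋃ e ∈ T, W e := by
        by_contra hcon
        exact hv1 ⟨e', ⟨subset_tsupport F hF, hcon⟩, hs⟩
      simp only [Set.mem_iUnion] at this
      obtain ⟨e, he, heW⟩ := this
      refine ⟨e, he, ?_⟩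
      exact E.isLocalHomeomorph_s.injOn_localInverseAt_target (x := e) (hv2 e he).1.2 heW.2
        (by rw [hsec e he, hs])
    · rintro ⟨⟨e, he, rfl⟩, hF⟩
      exact ⟨hsec e he, hF⟩
  have hcont : ContinuousAt (fun v => ∑ e ∈ T, F (lh e v)) v₀ := by
    refine tendsto_finsetSum _ fun e he => ?_
    exact (F.continuous.continuousAt.comp (hloc e he).1)
  exact hcont.congr (hev.mono fun _ h => h.symm)

/-- Sum over the fibres of the source map. -/
def fiberSum (F : C_c(E₁, ℂ)) : C₀(E₀, ℂ) where
  toFun v := ∑ᶠ e ∈ E.s ⁻¹' {v}, F e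
  continuous_toFun := E.continuous_fiberSum F
  zero_at_infty' := by
    have hK : IsCompact (E.s '' tsupport F) := F.hasCompactSupport'.image E.continuous_s
    refine tendsto_const_nhds.congr' ?_
    filter_upwards [hK.compl_mem_cocompact] with v hv
    symm
    refine finsum_mem_eq_zero_of_forall_eq_zero fun e he => ?_
    by_contra hne
    exact hv ⟨e, subset_tsupport F hne, he⟩

end FiberSum

/-! ### The graph correspondence -/

/-- The vector space `C_c(E₁)`, to be given the norm `‖x‖ = ‖⟨x, x⟩‖ ^ (1/2)`. -/
def PreCorr (_E : TopologicalGraph E₀ E₁) : Type v := C_c(E₁, ℂ)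

namespace PreCorr

variable {E}

instance : AddCommGroup E.PreCorr := inferInstanceAs (AddCommGroup C_c(E₁, ℂ))

instance : Module ℂ E.PreCorr := inferInstanceAs (Module ℂ C_c(E₁, ℂ))

/-- The identity map. -/
def of (E : TopologicalGraph E₀ E₁) : C_c(E₁, ℂ) ≃ₗ[ℂ] E.PreCorr := LinearEquiv.refl ℂ _

end PreCorr

/-- `⟨x, y⟩(v) = ∑_{s(e) = v} conj(x e) y e`. -/
def innerCc (x y : C_c(E₁, ℂ)) : C₀(E₀, ℂ) := E.fiberSum (star x * y)

theorem innerCc_apply (x y : C_c(E₁, ℂ)) (v : E₀) :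
    E.innerCc x y v = ∑ᶠ e ∈ E.s ⁻¹' {v}, star (x e) * y e := rfl

theorem fiberSum_add (F G : C_c(E₁, ℂ)) :
    E.fiberSum (F + G) = E.fiberSum F + E.fiberSum G := by
  ext v
  exact finsum_mem_add_distrib' (E.finite_fiber_support F v) (E.finite_fiber_support G v)

theorem fiberSum_smul (c : ℂ) (F : C_c(E₁, ℂ)) :
    E.fiberSum (c • F) = c • E.fiberSum F := by
  ext v
  change (∑ᶠ e ∈ E.s ⁻¹' {v}, c * F e) = c * ∑ᶠ e ∈ E.s ⁻¹' {v}, F e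
  exact (AddMonoidHom.map_finsum_mem' (AddMonoidHom.mulLeft c) (E.finite_fiber_support F v)).symm

theorem star_fiberSum (F : C_c(E₁, ℂ)) :
    star (E.fiberSum F) = E.fiberSum (star F) := by
  ext v
  change star (∑ᶠ e ∈ E.s ⁻¹' {v}, F e) = ∑ᶠ e ∈ E.s ⁻¹' {v}, star (F e)
  exact AddMonoidHom.map_finsum_mem' (starAddEquiv : ℂ ≃+ ℂ).toAddMonoidHom (E.finite_fiber_support F v)

/-- `(x · f)(e) = x(e) f(s(e))` -/
def rmul (x : C_c(E₁, ℂ)) (f : C₀(E₀, ℂ)) : C_c(E₁, ℂ) where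
  toFun e := x e * f (E.s e)
  continuous_toFun := x.continuous.mul (f.continuous.comp E.continuous_s)
  hasCompactSupport' := x.hasCompactSupport'.mul_right

/-- `(f · x)(e) = f(r(e)) x(e)` -/
def lmul (f : C₀(E₀, ℂ)) (x : C_c(E₁, ℂ)) : C_c(E₁, ℂ) where
  toFun e := f (E.r e) * x e
  continuous_toFun := (f.continuous.comp E.continuous_r).mul x.continuous
  hasCompactSupport' := x.hasCompactSupport'.mul_left

theorem innerCc_add_right (x y z : C_c(E₁, ℂ)) :
    E.innerCc x (y + z) = E.innerCc x y + E.innerCc x z := by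
  simp only [innerCc, mul_add, fiberSum_add]

theorem innerCc_smul_right (c : ℂ) (x y : C_c(E₁, ℂ)) :
    E.innerCc x (c • y) = c • E.innerCc x y := by
  simp only [innerCc, mul_smul_comm, fiberSum_smul]

theorem star_innerCc (x y : C_c(E₁, ℂ)) : star (E.innerCc x y) = E.innerCc y x := by
  have : star (star x * y) = star y * x := by
    ext e
    change star (star (x e) * y e) = star (y e) * x e
    rw [star_mul, star_star]
  rw [innerCc, star_fiberSum, this, innerCc]

theorem innerCc_rmul (x y : C_c(E₁, ℂ)) (f : C₀(E₀, ℂ)) :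
    E.innerCc x (E.rmul y f) = E.innerCc x y * f := by
  ext v
  rw [ZeroAtInftyContinuousMap.mul_apply, innerCc_apply, innerCc_apply]
  refine Eq.trans ?_ (AddMonoidHom.map_finsum_mem' (AddMonoidHom.mulRight (f v))
    (E.finite_fiber_support (star x * y) v)).symm
  refine finsum_mem_congr rfl fun e he => ?_
  have he' : E.s e = v := he
  change star (x e) * (y e * f (E.s e)) = _
  rw [he', ← mul_assoc]; rfl

theorem innerCc_lmul (x y : C_c(E₁, ℂ)) (f : C₀(E₀, ℂ)) :
    E.innerCc (E.lmul (star f) x) y = E.innerCc x (E.lmul f y) := by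
  have : star (E.lmul (star f) x) * y = star x * E.lmul f y := by
    ext e
    change star (star (f (E.r e)) * x e) * y e = star (x e) * (f (E.r e) * y e)
    rw [star_mul, star_star]; ring
  simp only [innerCc, this]

section Order
open scoped ComplexOrder

theorem innerCc_self_nonneg (x : C_c(E₁, ℂ)) (v : E₀) : 0 ≤ E.innerCc x x v := by
  rw [innerCc_apply]
  exact finsum_nonneg fun e => finsum_nonneg fun _ => star_mul_self_nonneg (x e)

theorem norm_sq_le_innerCc (x : C_c(E₁, ℂ)) (e : E₁) :
    ((‖x e‖ ^ 2 : ℝ) : ℂ) ≤ E.innerCc x x (E.s e) := by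
  have h1 : ((‖x e‖ ^ 2 : ℝ) : ℂ) = star (x e) * x e := by
    rw [Complex.star_def, Complex.conj_mul']; push_cast; rfl
  rw [innerCc_apply, h1]
  have hf : (E.s ⁻¹' {E.s e} ∩ Function.support fun e => star (x e) * x e).Finite :=
    E.finite_fiber_support (star x * x) _
  rw [← finsum_mem_inter_support, finsum_mem_eq_finite_toFinset_sum (fun e => star (x e) * x e) hf]
  by_cases h0 : star (x e) * x e = 0
  · rw [h0]; exact Finset.sum_nonneg fun e _ => star_mul_self_nonneg (x e)
  · exact Finset.single_le_sum (f := fun e => star (x e) * x e)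
      (fun e _ => star_mul_self_nonneg (x e)) (by simpa using h0)

theorem innerCc_self_eq_zero {x : C_c(E₁, ℂ)} (h : E.innerCc x x = 0) : x = 0 := by
  ext e
  have := E.norm_sq_le_innerCc x e
  rw [h, ZeroAtInftyContinuousMap.zero_apply] at this
  norm_cast at this
  simpa using le_antisymm this (by positivity)

theorem exists_eq_star_mul_self (a : C₀(E₀, ℂ)) (h : ∀ v, 0 ≤ a v) :
    ∃ b : C₀(E₀, ℂ), a = star b * b := by
  have hc : Continuous fun z : ℂ => ((Real.sqrt z.re : ℝ) : ℂ) := by fun_prop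
  refine ⟨⟨⟨fun v => ((Real.sqrt (a v).re : ℝ) : ℂ), hc.comp a.continuous⟩, ?_⟩, ?_⟩
  · have := (hc.tendsto 0).comp a.zero_at_infty'
    simpa [Function.comp_def] using this
  · ext v
    change a v = star ((Real.sqrt (a v).re : ℝ) : ℂ) * ((Real.sqrt (a v).re : ℝ) : ℂ)
    obtain ⟨h1, h2⟩ := Complex.nonneg_iff.1 (h v)
    rw [Complex.star_def, Complex.conj_ofReal, ← Complex.ofReal_mul, Real.mul_self_sqrt h1]
    exact Complex.ext rfl h2.symm

end Order

namespace PreCorr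

variable {E}

instance : Norm E.PreCorr where
  norm x := √‖E.innerCc ((of E).symm x) ((of E).symm x)‖

theorem norm_def (x : E.PreCorr) : ‖x‖ = √‖E.innerCc ((of E).symm x) ((of E).symm x)‖ := rfl

theorem core_and_cauchySchwarz :
    NormedSpace.Core ℂ E.PreCorr ∧ ∀ x y : E.PreCorr,
      ‖E.innerCc ((of E).symm x) ((of E).symm y)‖ ≤ ‖x‖ * ‖y‖ := by
  let _ : PartialOrder C₀(E₀, ℂ) := CStarAlgebra.spectralOrder _
  have _ : StarOrderedRing C₀(E₀, ℂ) := CStarAlgebra.spectralOrderedRing _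
  let _ : SMul C₀(E₀, ℂ) E.PreCorr := ⟨fun f x => of E (E.rmul ((of E).symm x) f)⟩
  let _ : CStarModule C₀(E₀, ℂ) E.PreCorr :=
    { inner := fun x y => E.innerCc ((of E).symm x) ((of E).symm y)
      inner_add_right := by intro x y z; exact E.innerCc_add_right _ _ _
      inner_self_nonneg := by
        intro x
        obtain ⟨b, hb⟩ := exists_eq_star_mul_self (E.innerCc ((of E).symm x) ((of E).symm x))
          (E.innerCc_self_nonneg _)
        change 0 ≤ E.innerCc ((of E).symm x) ((of E).symm x)
        rw [hb]
        exact star_mul_self_nonneg b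
      inner_self := by
        intro x
        constructor
        · intro h
          exact E.innerCc_self_eq_zero h
        · rintro rfl
          have := E.innerCc_smul_right 0 (0 : C_c(E₁, ℂ)) 0
          simpa using this
      inner_op_smul_right := by
        intro a x y
        exact (E.innerCc_rmul _ _ _).trans (mul_comm _ _)
      inner_smul_right_complex := by intro z x y; exact E.innerCc_smul_right _ _ _
      star_inner := fun x y => E.star_innerCc _ _
      norm_eq_sqrt_norm_inner_self := fun x => rfl }
  exact ⟨CStarModule.normedSpaceCore C₀(E₀, ℂ),
    fun x y => CStarModule.norm_inner_le (A := C₀(E₀, ℂ)) E.PreCorr⟩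

instance : NormedAddCommGroup E.PreCorr := NormedAddCommGroup.ofCore core_and_cauchySchwarz.1

instance : NormedSpace ℂ E.PreCorr := NormedSpace.ofCore core_and_cauchySchwarz.1

theorem norm_inner_le (x y : E.PreCorr) :
    ‖E.innerCc ((of E).symm x) ((of E).symm y)‖ ≤ ‖x‖ * ‖y‖ := core_and_cauchySchwarz.2 x y

end PreCorr

/-- The Banach space `X(E)`: the completion of `C_c(E₁)` in the norm `‖⟨x, x⟩‖ ^ (1/2)`. -/
abbrev CorrSpace : Type v := UniformSpace.Completion E.PreCorr

section Completion

open UniformSpace PreCorr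

/-- The canonical embedding of `C_c(E₁)` in `X(E)`. -/
def toCorr : C_c(E₁, ℂ) →ₗ[ℂ] E.CorrSpace :=
  (Completion.toComplL (𝕜 := ℂ) (E := E.PreCorr)).toLinearMap.comp (of E).toLinearMap

theorem norm_toCorr_sq (x : C_c(E₁, ℂ)) : ‖E.toCorr x‖ ^ 2 = ‖E.innerCc x x‖ := by
  have h : ‖E.toCorr x‖ = ‖of E x‖ := Completion.norm_coe (of E x)
  rw [h, PreCorr.norm_def, Real.sq_sqrt (norm_nonneg _)]
  rfl

theorem innerCc_add_left (x y z : C_c(E₁, ℂ)) :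
    E.innerCc (x + y) z = E.innerCc x z + E.innerCc y z := by
  rw [← E.star_innerCc, innerCc_add_right, star_add, star_innerCc, star_innerCc]

theorem innerCc_smul_left (c : ℂ) (x y : C_c(E₁, ℂ)) :
    E.innerCc (c • x) y = star c • E.innerCc x y := by
  rw [← E.star_innerCc, innerCc_smul_right, star_smul, star_innerCc]

/-- The inner product of `C_c(E₁)` as a sesquilinear map. -/
def innerₛₗ : E.PreCorr →ₗ⋆[ℂ] E.PreCorr →ₗ[ℂ] C₀(E₀, ℂ) where
  toFun x :=
    { toFun := fun y => E.innerCc ((of E).symm x) ((of E).symm y)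
      map_add' := fun _ _ => E.innerCc_add_right _ _ _
      map_smul' := fun _ _ => E.innerCc_smul_right _ _ _ }
  map_add' _ _ := LinearMap.ext fun _ => E.innerCc_add_left _ _ _
  map_smul' _ _ := LinearMap.ext fun _ => E.innerCc_smul_left _ _ _

/-- The inner product of `X(E)`: the continuous extension of that of `C_c(E₁)`. -/
def corrInner : E.CorrSpace →L⋆[ℂ] E.CorrSpace →L[ℂ] C₀(E₀, ℂ) :=
  sesqExtend E.innerₛₗ fun x y => PreCorr.norm_inner_le x y

theorem corrInner_coe (x y : E.PreCorr) :
    E.corrInner (x : E.CorrSpace) (y : E.CorrSpace) =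
      E.innerCc ((of E).symm x) ((of E).symm y) :=
  sesqExtend_coe E.innerₛₗ (fun x y => PreCorr.norm_inner_le x y) x y

theorem norm_rmul_le (x : E.PreCorr) (f : C₀(E₀, ℂ)) :
    ‖of E (E.rmul ((of E).symm x) f)‖ ≤ ‖x‖ * ‖f‖ := by
  set x' := (of E).symm x
  have h1 : E.innerCc (E.rmul x' f) (E.rmul x' f) = star f * E.innerCc x' x' * f := by
    rw [innerCc_rmul, ← E.star_innerCc, innerCc_rmul]
    have h2 : star (E.innerCc x' x' * f) = star f * star (E.innerCc x' x') :=
      star_mul (E.innerCc x' x') f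
    rw [h2, star_innerCc]
  rw [PreCorr.norm_def, PreCorr.norm_def, LinearEquiv.symm_apply_apply, h1]
  refine Real.sqrt_le_iff.2 ⟨by positivity, ?_⟩
  calc ‖star f * E.innerCc x' x' * f‖ ≤ ‖star f‖ * ‖E.innerCc x' x'‖ * ‖f‖ :=
        (norm_mul_le _ _).trans (by gcongr; exact norm_mul_le _ _)
    _ = (√‖E.innerCc x' x'‖ * ‖f‖) ^ 2 := by
        rw [show ‖star f‖ = ‖f‖ from norm_star f, mul_pow, Real.sq_sqrt (norm_nonneg _)]; ring

/-- The right action of `C₀(E₀)` on `X(E)`: the continuous extension of that on `C_c(E₁)`. -/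
def corrRact : E.CorrSpace →L[ℂ] C₀(E₀, ℂ) →L[ℂ] E.CorrSpace :=
  (LinearMap.mkContinuous₂
    (LinearMap.mk₂ ℂ (fun (x : E.PreCorr) (f : C₀(E₀, ℂ)) => E.toCorr (E.rmul ((of E).symm x) f))
      (fun x y f => by
        rw [← map_add]; congr 1; ext e; exact add_mul _ _ _)
      (fun c x f => by
        rw [← map_smul]; congr 1; ext e; exact mul_assoc _ _ _)
      (fun x f g => by
        rw [← map_add]; congr 1; ext e; exact mul_add _ _ _)
      (fun c x f => by
        rw [← map_smul]; congr 1; ext e; exact mul_left_comm _ _ _)) 1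
    fun x f => by
      rw [one_mul]
      exact (Completion.norm_coe _).trans_le (E.norm_rmul_le x f)).fromCompletion

theorem corrRact_coe (x : E.PreCorr) (f : C₀(E₀, ℂ)) :
    E.corrRact (x : E.CorrSpace) f = E.toCorr (E.rmul ((of E).symm x) f) := by
  simp [corrRact]

section Order
open scoped ComplexOrder

theorem innerCc_mono_of_norm_le {x y : C_c(E₁, ℂ)} {c : ℝ}
    (h : ∀ e, ‖y e‖ ≤ c * ‖x e‖) (v : E₀) :
    ‖E.innerCc y y v‖ ≤ c ^ 2 * ‖E.innerCc x x v‖ := by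
  have key : ∀ z : C_c(E₁, ℂ), E.innerCc z z v = ((∑ᶠ e ∈ E.s ⁻¹' {v}, ‖z e‖ ^ 2 : ℝ) : ℂ) := by
    intro z
    have hf : (E.s ⁻¹' {v} ∩ Function.support fun e => ‖z e‖ ^ 2).Finite :=
      (E.finite_fiber_support z v).subset fun e he => ⟨he.1, fun h0 => he.2 (by simp [h0])⟩
    refine Eq.trans ?_ (AddMonoidHom.map_finsum_mem' Complex.ofRealHom.toAddMonoidHom hf).symm
    refine finsum_mem_congr rfl fun e _ => ?_
    change star (z e) * z e = ((‖z e‖ ^ 2 : ℝ) : ℂ)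
    rw [Complex.star_def, Complex.conj_mul']; push_cast; rfl
  have hnn : ∀ z : C_c(E₁, ℂ), 0 ≤ ∑ᶠ e ∈ E.s ⁻¹' {v}, ‖z e‖ ^ 2 := fun z =>
    finsum_nonneg fun e => finsum_nonneg fun _ => by positivity
  have hf : ∀ z : C_c(E₁, ℂ), (E.s ⁻¹' {v} ∩ Function.support z).Finite := fun z =>
    E.finite_fiber_support z v
  rw [key, key, Complex.norm_real, Complex.norm_real, Real.norm_of_nonneg (hnn _),
    Real.norm_of_nonneg (hnn _)]
  set T := ((hf x).union (hf y)).toFinset with hT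
  have hsum : ∀ z : C_c(E₁, ℂ), (E.s ⁻¹' {v} ∩ Function.support z : Set E₁) ⊆ T →
      (∑ᶠ e ∈ E.s ⁻¹' {v}, ‖z e‖ ^ 2) = ∑ e ∈ T, ‖z e‖ ^ 2 := by
    intro z hz
    refine finsum_mem_eq_sum_of_inter_support_eq _ ?_
    ext e
    constructor
    · rintro ⟨h1, h2⟩
      exact ⟨hz ⟨h1, fun h0 => h2 (by simp [h0])⟩, h2⟩
    · rintro ⟨h1, h2⟩
      refine ⟨?_, h2⟩
      simp only [hT, Set.Finite.coe_toFinset] at h1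
      exact h1.elim (fun h => h.1) fun h => h.1
  rw [hsum x (by rw [hT]; intro e he; simpa using Or.inl he),
    hsum y (by rw [hT]; intro e he; simpa using Or.inr he), Finset.mul_sum]
  refine Finset.sum_le_sum fun e _ => ?_
  rw [← mul_pow]
  exact pow_le_pow_left₀ (norm_nonneg _) (h e) 2

end Order

theorem norm_lmul_le (f : C₀(E₀, ℂ)) (x : E.PreCorr) :
    ‖of E (E.lmul f ((of E).symm x))‖ ≤ ‖f‖ * ‖x‖ := by
  set x' := (of E).symm x
  rw [PreCorr.norm_def, PreCorr.norm_def, LinearEquiv.symm_apply_apply]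
  refine Real.sqrt_le_iff.2 ⟨by positivity, ?_⟩
  rw [mul_pow, Real.sq_sqrt (norm_nonneg _), ← ZeroAtInftyContinuousMap.norm_toBCF_eq_norm]
  refine (BoundedContinuousFunction.norm_le (by positivity)).2 fun v => ?_
  refine (E.innerCc_mono_of_norm_le (x := x') (c := ‖f‖) (fun e => ?_) v).trans ?_
  · change ‖f (E.r e) * x' e‖ ≤ _
    rw [norm_mul]
    gcongr
    exact (BoundedContinuousFunction.norm_coe_le_norm f.toBCF (E.r e))
  · gcongr
    exact (BoundedContinuousFunction.norm_coe_le_norm (E.innerCc x' x').toBCF v)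

/-- The left action of `C₀(E₀)` on `C_c(E₁)`, as bounded operators. -/
def lmulL (f : C₀(E₀, ℂ)) : E.PreCorr →L[ℂ] E.PreCorr :=
  LinearMap.mkContinuous
    { toFun := fun x => of E (E.lmul f ((of E).symm x))
      map_add' := fun x y => by
        rw [← map_add]; congr 1; ext e; exact mul_add _ _ _
      map_smul' := fun c x => by
        rw [RingHom.id_apply, ← map_smul]; congr 1; ext e; exact mul_left_comm _ _ _ }
    ‖f‖ fun x => E.norm_lmul_le f x

theorem lmulL_apply (f : C₀(E₀, ℂ)) (x : E.PreCorr) :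
    E.lmulL f x = of E (E.lmul f ((of E).symm x)) := rfl

theorem completion_coe (T : E.PreCorr →L[ℂ] E.PreCorr) (x : E.PreCorr) :
    T.completion (x : E.CorrSpace) = ((T x : E.PreCorr) : E.CorrSpace) := by
  simp

theorem lmulL_completion_coe (f : C₀(E₀, ℂ)) (x : E.PreCorr) :
    (E.lmulL f).completion (x : E.CorrSpace) = E.toCorr (E.lmul f ((of E).symm x)) := by
  rw [completion_coe]; rfl

theorem toCorr_eq {x y : C_c(E₁, ℂ)} (h : ∀ e, x e = y e) : E.toCorr x = E.toCorr y :=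
  congrArg _ (CompactlySupportedContinuousMap.ext h)

/-- The left action of `C₀(E₀)` on `X(E)`: the continuous extension of that on `C_c(E₁)`. -/
def corrLact : C₀(E₀, ℂ) →ₙₐ[ℂ] (E.CorrSpace →L[ℂ] E.CorrSpace) where
  toFun f := (E.lmulL f).completion
  map_smul' c f := by
    refine completion_clm_ext fun x => ?_
    rw [MonoidHom.id_apply, smul_apply, lmulL_completion_coe,
        lmulL_completion_coe, ← map_smul]
    exact E.toCorr_eq fun e => mul_assoc _ _ _
  map_zero' := by
    refine completion_clm_ext fun x => ?_
    rw [zero_apply, lmulL_completion_coe, ← map_zero E.toCorr]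
    exact E.toCorr_eq fun e => zero_mul _
  map_add' f g := by
    refine completion_clm_ext fun x => ?_
    rw [add_apply, lmulL_completion_coe, lmulL_completion_coe,
        lmulL_completion_coe, ← map_add]
    exact E.toCorr_eq fun e => add_mul _ _ _
  map_mul' f g := by
    refine completion_clm_ext fun x => ?_
    rw [lmulL_completion_coe]
    change _ = (E.lmulL f).completion ((E.lmulL g).completion (x : E.CorrSpace))
    rw [lmulL_completion_coe]
    refine Eq.trans ?_ (E.lmulL_completion_coe f (of E (E.lmul g ((of E).symm x)))).symm
    exact E.toCorr_eq fun e => mul_assoc _ _ _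

theorem corrLact_coe (f : C₀(E₀, ℂ)) (x : E.PreCorr) :
    E.corrLact f (x : E.CorrSpace) = E.toCorr (E.lmul f ((of E).symm x)) :=
  E.lmulL_completion_coe f x

open scoped ComplexOrder in
/-- The graph correspondence `X(E)` over `C₀(E₀)`: the completion of `C_c(E₁)`, with the inner
product and the actions extended by continuity. -/
def graphCorr : CStarCorrespondence C₀(E₀, ℂ) E.CorrSpace where
  inner := E.corrInner
  ract := E.corrRact
  lact := E.corrLact
  ract_mul x f g := by
    induction x using Completion.induction_on with
    | hp => exact isClosed_eq (by fun_prop) (by fun_prop)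
    | ih x =>
      rw [corrRact_coe, corrRact_coe]
      refine Eq.trans ?_ (E.corrRact_coe (of E (E.rmul ((of E).symm x) f)) g).symm
      congr 1; ext e; exact (mul_assoc _ _ _).symm
  inner_ract x y f := by
    induction x, y using Completion.induction_on₂ with
    | hp => exact isClosed_eq (by fun_prop) (by fun_prop)
    | ih x y =>
      rw [corrRact_coe, corrInner_coe]
      refine (E.corrInner_coe x (of E (E.rmul ((of E).symm y) f))).trans ?_
      exact E.innerCc_rmul _ _ _
  star_inner x y := by
    induction x, y using Completion.induction_on₂ with
    | hp => exact isClosed_eq (by fun_prop) (by fun_prop)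
    | ih x y => rw [corrInner_coe, corrInner_coe, star_innerCc]
  inner_self_nonneg x := by
    refine exists_eq_star_mul_self _ fun v => ?_
    induction x using Completion.induction_on with
    | hp =>
      have hv : Continuous fun f : C₀(E₀, ℂ) => f v :=
        (BoundedContinuousFunction.lipschitz_eval_const v).continuous.comp
          ZeroAtInftyContinuousMap.isometry_toBCF.continuous
      exact isClosed_le continuous_const (hv.comp (by fun_prop))
    | ih x => rw [corrInner_coe]; exact E.innerCc_self_nonneg _ v
  norm_sq_eq x := by
    induction x using Completion.induction_on with
    | hp => exact isClosed_eq (by fun_prop) (by fun_prop)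
    | ih x => rw [corrInner_coe]; exact E.norm_toCorr_sq ((of E).symm x)
  inner_lact f x y := by
    induction x, y using Completion.induction_on₂ with
    | hp => exact isClosed_eq (by fun_prop) (by fun_prop)
    | ih x y =>
      rw [corrLact_coe, corrLact_coe]
      refine (E.corrInner_coe (of E (E.lmul (star f) ((of E).symm y))) x).trans ?_
      refine Eq.trans ?_ (E.corrInner_coe y (of E (E.lmul f ((of E).symm x)))).symm
      exact E.innerCc_lmul _ _ _

end Completion

/-! ### Covariant Toeplitz representations of a topological graph -/

/-- An `s`-section: a set on which `s` is a homeomorphism onto its image. -/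
def IsSSection (U : Set E₁) : Prop := Topology.IsEmbedding (U.domRestrict E.s)

/-- `g` is the function `x̂`: `x̂(s(e)) = |x(e)|²` for `e ∈ osupp(x)`, and `x̂` vanishes off
`s(osupp(x))`. It exists, and is unique, whenever `osupp(x)` is an `s`-section. -/
def IsHat (x : C_c(E₁, ℂ)) (g : C₀(E₀, ℂ)) : Prop :=
  (∀ e ∈ Function.support x, g (E.s e) = ((‖x e‖ ^ 2 : ℝ) : ℂ)) ∧
    ∀ v ∉ E.s '' Function.support x, g v = 0

theorem isHat_innerCc {x : C_c(E₁, ℂ)} (hx : E.IsSSection (Function.support x)) :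
    E.IsHat x (E.innerCc x x) := by
  constructor
  · intro e he
    rw [innerCc_apply, finsum_mem_inter_support_eq _ _ {e} ?_]
    · rw [finsum_mem_singleton, Complex.star_def, Complex.conj_mul']; push_cast; rfl
    · ext e'
      constructor
      · rintro ⟨h1, h2⟩
        have h3 : e' ∈ Function.support x := fun h0 => h2 (by simp [h0])
        have h4 : (⟨e', h3⟩ : Function.support x) = ⟨e, he⟩ := hx.injective h1
        exact ⟨congrArg Subtype.val h4, h2⟩
      · rintro ⟨h1, h2⟩
        exact ⟨congrArg E.s h1, h2⟩
  · intro v hv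
    rw [innerCc_apply]
    refine finsum_mem_eq_zero_of_forall_eq_zero fun e he => ?_
    have : x e = 0 := by
      by_contra h0
      exact hv ⟨e, h0, he⟩
    simp [this]

/-- Toeplitz representations of a topological graph. -/
structure IsToeplitzRep {B : Type*} [NonUnitalCStarAlgebra B] (ψ : C_c(E₁, ℂ) →ₗ[ℂ] B)
    (π : C₀(E₀, ℂ) →⋆ₙₐ[ℂ] B) : Prop where
  map_lmul : ∀ (f : C₀(E₀, ℂ)) (x : C_c(E₁, ℂ)), ψ (E.lmul f x) = π f * ψ x
  map_hat : ∀ (x : C_c(E₁, ℂ)) (U : Set E₁), IsOpen U → E.IsSSection U → tsupport x ⊆ U →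
    ∀ g : C₀(E₀, ℂ), E.IsHat x g → π g = star (ψ x) * ψ x
  orthogonal : ∀ (x y : C_c(E₁, ℂ)) (U W : Set E₁), IsOpen U → IsOpen W → E.IsSSection U →
    E.IsSSection W → Disjoint U W → tsupport x ⊆ U → tsupport y ⊆ W → star (ψ x) * ψ y = 0

/-- `E⁰_sce`. -/
def sceSet : Set E₀ := (closure (Set.range E.r))ᶜ

/-- `E⁰_fin`. -/
def finSet : Set E₀ := {v | ∃ N ∈ nhds v, IsCompact (E.r ⁻¹' N)}

/-- `E⁰_rg`. -/
def rgSet : Set E₀ := E.finSet \ closure E.sceSet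

/-- The square root of a nonnegative function in `C_c(E₁)`. -/
def sqrtCc (f : C_c(E₁, NNReal)) : C_c(E₁, ℂ) where
  toFun e := ((NNReal.sqrt (f e) : ℝ) : ℂ)
  continuous_toFun := by fun_prop
  hasCompactSupport' := f.hasCompactSupport'.comp_left (g := fun t => ((NNReal.sqrt t : ℝ) : ℂ))
    (by simp)

open scoped ComplexOrder in
/-- Covariant Toeplitz representations of a topological graph. Here `C_c(E⁰_rg)` and `C₀(E⁰_rg)`
are regarded as subsets of `C₀(E₀)`, and the functions `f_N`, which vanish off the compact set
`r⁻¹(supp f)`, as elements of `C_c(E₁)`. -/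
structure IsCovariantRep {B : Type*} [NonUnitalCStarAlgebra B] (ψ : C_c(E₁, ℂ) →ₗ[ℂ] B)
    (π : C₀(E₀, ℂ) →⋆ₙₐ[ℂ] B) : Prop extends E.IsToeplitzRep ψ π where
  covariant : ∃ 𝒢 : Set C₀(E₀, ℂ),
    (∀ f ∈ 𝒢, HasCompactSupport f ∧ tsupport f ⊆ E.rgSet ∧ ∀ v, 0 ≤ f v) ∧
    ((NonUnitalStarAlgebra.adjoin ℂ 𝒢).topologicalClosure : Set C₀(E₀, ℂ)) =
      {f | ∀ v ∉ E.rgSet, f v = 0} ∧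
    ∀ f ∈ 𝒢, ∃ (𝒩 : Finset (Set E₁)) (F : Set E₁ → C_c(E₁, NNReal)),
      (∀ N ∈ 𝒩, IsOpen N ∧ E.IsSSection N) ∧
      E.r ⁻¹' tsupport f ⊆ ⋃ N ∈ 𝒩, N ∧
      (∀ N ∈ 𝒩, Function.support (F N) ⊆ N ∩ E.r ⁻¹' tsupport f) ∧
      (∀ e, ∑ N ∈ 𝒩, ((F N e : ℝ) : ℂ) = f (E.r e)) ∧
      π f = ∑ N ∈ 𝒩, ψ (sqrtCc (F N)) * star (ψ (sqrtCc (F N)))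

/-- Universal covariant Toeplitz representations of a topological graph. -/
structure IsUniversalCovariantRep {B : Type w} [NonUnitalCStarAlgebra B]
    (ψ : C_c(E₁, ℂ) →ₗ[ℂ] B) (π : C₀(E₀, ℂ) →⋆ₙₐ[ℂ] B) : Prop extends E.IsCovariantRep ψ π where
  universal : ∀ (D : Type w) [NonUnitalCStarAlgebra D] (ψ' : C_c(E₁, ℂ) →ₗ[ℂ] D)
    (π' : C₀(E₀, ℂ) →⋆ₙₐ[ℂ] D), E.IsCovariantRep ψ' π' →
    ∃ h : B →⋆ₙₐ[ℂ] D, (∀ x, h (ψ x) = ψ' x) ∧ ∀ f, h (π f) = π' f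

end TopologicalGraph

end

noncomputable section

/-! A representation of `E` and a representation of the correspondence `X(E)` are the same thing,
seen on `C_c(E₁)` and on its completion. Once this is known for covariant Toeplitz representations,
the universal property of `𝒪_{X(E)}` becomes the universal property for `E`, and any two universal
representations generate isomorphic algebras.

Toeplitz part. Condition (2) is the norm identity `ψ(x)⋆ψ(x) = π(⟨x, x⟩)` for `x` supported in an
`s`-section. Polarization inside one section, condition (3) for disjoint sections and a partition of
unity give `ψ(x)⋆ψ(y) = π(⟨x, y⟩)` for all `x`, `y` (`IsToeplitzRep.star_mul`). Hence `ψ` is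
contractive for the norm of `X(E)` and extends to it.

Covariant part. If `f ∘ r = ∑ f_N` with each `f_N` supported in an `s`-section, then `φ(f) = ∑
Θ_{√f_N, √f_N}` (`lact_eq_sum_theta`), so the covariance condition of `E` at `f` says `ψ⁽¹⁾(φ(f)) =
π(f)`. Such an `f` with support in `E⁰_rg` lies in the Katsura ideal, which settles one direction.
For the other, the functions `f` with `ψ⁽¹⁾(φ(f)) = π(f)` form a closed algebra; it contains the
generators of `C₀(E⁰_rg)`, and the Katsura ideal lies in `C₀(E⁰_rg)`
(`eq_zero_of_mem_katsuraIdeal`).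

Two general facts support this. The homomorphism `ψ⁽¹⁾` exists for every Toeplitz representation
(`exists_isCompactsHom`), by a comparison of norms through high powers. The algebra `𝒪_X` exists as
the subalgebra generated inside a bounded product of sufficiently many covariant representations
(`exists_isCuntzPimsnerAlgebra`). -/

theorem le_of_forall_pow_two_pow_le {a b M : ℝ} (ha : 0 ≤ a) (hb : 0 ≤ b)
    (h : ∀ n : ℕ, 1 ≤ n → a ^ 2 ^ n ≤ M * b ^ (2 ^ n - 1)) : a ≤ b := by
  by_contra! hab
  have ha0 : 0 < a := hb.trans_lt hab
  have hexp : Filter.Tendsto (fun n : ℕ => 2 ^ n - 1) Filter.atTop Filter.atTop :=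
    (Filter.tendsto_sub_atTop_nat 1).comp (tendsto_pow_atTop_atTop_of_one_lt one_lt_two)
  -- Division by `a ^ (2 ^ n - 1)` turns the hypothesis into `a ≤ M (b / a) ^ (2 ^ n - 1)`, whose
  -- right side tends to `0` when `b < a`.
  have hlim : Filter.Tendsto (fun n : ℕ => M * (b / a) ^ (2 ^ n - 1)) Filter.atTop (nhds (M * 0)) :=
    ((tendsto_pow_atTop_nhds_zero_of_lt_one (div_nonneg hb ha)
      ((div_lt_one ha0).2 hab)).comp hexp).const_mul M
  rw [mul_zero] at hlim
  refine ha0.not_ge (ge_of_tendsto hlim ?_)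
  filter_upwards [Filter.eventually_ge_atTop 1] with n hn
  have hpos : 1 ≤ 2 ^ n := Nat.one_le_two_pow
  have h1 := h n hn
  rw [div_pow, ← mul_div_assoc, le_div_iff₀ (by positivity), ← pow_succ',
    Nat.sub_add_cancel hpos]
  exact h1

/-- For self-adjoint `T`, `‖T‖ ^ 2 ^ n = ‖T ^ 2 ^ n‖`, so a bound on high powers suffices: neither
the constant `M` nor the missing factor `Θ` survives in the limit. Since `B` may have no unit, the
powers are the sequence `p k = T ^ (k + 1)`, compared with powers in the unitization. -/
theorem norm_le_of_self_adjoint_pow_bound {R B : Type*} [NormedRing R] [NonUnitalCStarAlgebra B]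
    {T : B} (hT : IsSelfAdjoint T) {Θ : R} {p : ℕ → B} (h0 : p 0 = T)
    (hp : ∀ k, p (k + 1) = p k * T) {M : ℝ} (hM : ∀ k, ‖p k * T‖ ≤ M * ‖Θ ^ (k + 1)‖)
    (hM0 : 0 ≤ M) : ‖T‖ ≤ ‖Θ‖ := by
  have hpow : ∀ k, (p k : Unitization ℂ B) = (T : Unitization ℂ B) ^ (k + 1) := by
    intro k
    induction k with
    | zero => simp [h0]
    | succ k ih => rw [hp, Unitization.inr_mul, ih, pow_succ _ (k + 1)]
  have hT' : IsSelfAdjoint (T : Unitization ℂ B) := by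
    rw [IsSelfAdjoint, ← Unitization.inr_star, hT.star_eq]
  refine le_of_forall_pow_two_pow_le (M := M) (norm_nonneg _) (norm_nonneg _) fun n hn => ?_
  obtain ⟨k, hk⟩ : ∃ k, 2 ^ n = k + 2 := by
    have : 2 ^ 1 ≤ 2 ^ n := Nat.pow_le_pow_right (by norm_num) hn
    exact ⟨2 ^ n - 2, by omega⟩
  have h1 : ‖T‖ ^ 2 ^ n = ‖(T : Unitization ℂ B) ^ 2 ^ n‖ := by
    have := congrArg NNReal.toReal (hT'.nnnorm_pow_two_pow n)
    simp only [coe_nnnorm, NNReal.coe_pow] at this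
    rw [this, Unitization.norm_inr]
  rw [h1, hk, ← hpow (k + 1), Unitization.norm_inr, hp]
  refine (hM k).trans ?_
  have : k + 2 - 1 = k + 1 := by omega
  rw [this]
  gcongr
  -- The exponent is positive, so `‖1‖ = 1` is not needed; it fails for operators on `X = 0`.
  exact norm_pow_le' Θ k.succ_pos

/-! ### The homomorphism of `𝒦(X)` induced by a Toeplitz representation -/

namespace CStarCorrespondence

variable {A X : Type*} [NonUnitalCStarAlgebra A] [NormedAddCommGroup X] [NormedSpace ℂ X]
  [CompleteSpace X] (C : CStarCorrespondence A X)

/-- `T` is an adjoint of `S`. -/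
def IsAdjoint (S T : X →L[ℂ] X) : Prop := ∀ x y, C.inner (T y) x = C.inner y (S x)

theorem ext_of_inner {x y : X} (h : ∀ z, C.inner z x = C.inner z y) : x = y := by
  rw [← sub_eq_zero, ← norm_eq_zero, ← sq_eq_zero_iff, C.norm_sq_eq, map_sub, h, sub_self,
    norm_zero]

theorem inner_ract_left (x y : X) (a : A) : C.inner (C.ract x a) y = star a * C.inner x y := by
  rw [← C.star_inner, C.inner_ract, star_mul, C.star_inner]

theorem theta_apply (x y z : X) : C.theta x y z = C.ract x (C.inner y z) := rfl

theorem isAdjoint_theta (x y : X) : C.IsAdjoint (C.theta x y) (C.theta y x) := fun z w => by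
  rw [theta_apply, theta_apply, inner_ract_left, C.inner_ract, C.star_inner]

/-- `S` is only assumed to be bounded and linear; having an adjoint is what makes it commute with
the right action. -/
theorem mul_theta {S T : X →L[ℂ] X} (h : C.IsAdjoint S T) (x y : X) :
    S * C.theta x y = C.theta (S x) y := by
  ext z
  refine C.ext_of_inner fun w => ?_
  change C.inner w (S (C.theta x y z)) = _
  rw [← h, theta_apply, theta_apply, C.inner_ract, C.inner_ract, h]

namespace IsAdjoint

variable {C} {S T S' T' : X →L[ℂ] X}

theorem add (h : C.IsAdjoint S T) (h' : C.IsAdjoint S' T') : C.IsAdjoint (S + S') (T + T') :=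
  fun x y => by simp [h x y, h' x y]

theorem smul (c : ℂ) (h : C.IsAdjoint S T) : C.IsAdjoint (c • S) (star c • T) :=
  fun x y => by simp [h x y]

theorem sub (h : C.IsAdjoint S T) (h' : C.IsAdjoint S' T') : C.IsAdjoint (S - S') (T - T') :=
  fun x y => by simp [h x y, h' x y]

theorem zero : C.IsAdjoint 0 0 := fun x y => by simp

/-- From `‖T y‖² = ‖⟨y, S T y⟩‖`. The norm of the inner product replaces the Cauchy–Schwarz constant
`1`; any finite constant is enough for the later continuity arguments. -/
theorem norm_le (h : C.IsAdjoint S T) : ‖T‖ ≤ ‖C.inner‖ * ‖S‖ := by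
  refine T.opNorm_le_bound (by positivity) fun y => ?_
  rcases (norm_nonneg (T y)).eq_or_lt with h0 | h0
  · rw [← h0]; positivity
  refine le_of_mul_le_mul_right ?_ h0
  calc ‖T y‖ * ‖T y‖ = ‖C.inner y (S (T y))‖ := by rw [← sq, C.norm_sq_eq, h]
    _ ≤ ‖C.inner‖ * ‖y‖ * ‖S (T y)‖ := C.inner.le_opNorm₂ _ _
    _ ≤ ‖C.inner‖ * ‖y‖ * (‖S‖ * ‖T y‖) := by gcongr; exact S.le_opNorm _
    _ = ‖C.inner‖ * ‖S‖ * ‖y‖ * ‖T y‖ := by ring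

end IsAdjoint

theorem compacts_induction {p : C.compacts → Prop} (hp : IsClosed {S | p S})
    (h : ∀ S : C.compacts, (S : X →L[ℂ] X) ∈ Submodule.span ℂ {T | ∃ x y, T = C.theta x y} → p S)
    (S : C.compacts) : p S := by
  have hS : S ∈ closure {S | p S} := by
    rw [closure_subtype]
    have hsub : (Submodule.span ℂ {T | ∃ x y, T = C.theta x y} : Set (X →L[ℂ] X)) ⊆
        Subtype.val '' {S : C.compacts | p S} := fun T hT =>
      ⟨⟨T, Submodule.le_topologicalClosure _ hT⟩, h _ hT, rfl⟩
    exact closure_mono hsub S.2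
  rwa [hp.closure_eq] at hS

theorem compacts_hom_ext {F : Type*} [NormedAddCommGroup F] [NormedSpace ℂ F]
    {Φ Ψ : C.compacts →L[ℂ] F}
    (h : ∀ x y, Φ ⟨C.theta x y, C.theta_mem_compacts x y⟩ =
      Ψ ⟨C.theta x y, C.theta_mem_compacts x y⟩) : Φ = Ψ := by
  ext1 S
  refine C.compacts_induction (p := fun S => Φ S = Ψ S)
    (isClosed_eq Φ.continuous Ψ.continuous) (fun S hS => ?_) S
  obtain ⟨S, hS'⟩ := S
  change S ∈ Submodule.span ℂ {T | ∃ x y, T = C.theta x y} at hS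
  induction hS using Submodule.span_induction with
  | mem T hT => obtain ⟨x, y, rfl⟩ := hT; exact h x y
  | zero => exact (map_zero Φ).trans (map_zero Ψ).symm
  | add T U hT hU ihT ihU =>
    have hT' : T ∈ C.compacts := Submodule.le_topologicalClosure _ hT
    have hU' : U ∈ C.compacts := Submodule.le_topologicalClosure _ hU
    refine (map_add Φ ⟨T, hT'⟩ ⟨U, hU'⟩).trans ?_
    rw [ihT hT', ihU hU']
    exact (map_add Ψ ⟨T, hT'⟩ ⟨U, hU'⟩).symm
  | smul c T hT ihT =>
    have hT' : T ∈ C.compacts := Submodule.le_topologicalClosure _ hT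
    refine (map_smul Φ c ⟨T, hT'⟩).trans ?_
    rw [ihT hT']
    exact (map_smul Ψ c ⟨T, hT'⟩).symm

section CompactsHom

variable {B : Type*} [NonUnitalCStarAlgebra B] {ψ : X →ₗ[ℂ] B} {π : A →⋆ₙₐ[ℂ] B}

/-- The linear relation spanned by the pairs `(Θ_{x,y}, ψ(x) ψ(y)⋆)`. -/
def thetaGraph (ψ : X →ₗ[ℂ] B) : Submodule ℂ ((X →L[ℂ] X) × B) :=
  Submodule.span ℂ {p | ∃ x y, p = (C.theta x y, ψ x * star (ψ y))}

variable {C}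

/-- Bounded operators on `X` need not be adjointable. In the span of the rank one operators an
adjoint can be chosen compatibly with the adjoint in `B`, because `Θ_{x,y}⋆ = Θ_{y,x}`. -/
theorem exists_adjoint_of_mem_thetaGraph {p : (X →L[ℂ] X) × B} (hp : p ∈ C.thetaGraph ψ) :
    ∃ T, C.IsAdjoint p.1 T ∧ (T, star p.2) ∈ C.thetaGraph ψ := by
  induction hp using Submodule.span_induction with
  | mem p hp =>
    obtain ⟨x, y, rfl⟩ := hp
    refine ⟨C.theta y x, C.isAdjoint_theta x y, Submodule.subset_span ⟨y, x, ?_⟩⟩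
    simp
  | zero =>
    refine ⟨0, IsAdjoint.zero, ?_⟩
    rw [Prod.snd_zero, star_zero]
    exact (C.thetaGraph ψ).zero_mem
  | add p q _ _ ihp ihq =>
    obtain ⟨S, hS, hS'⟩ := ihp
    obtain ⟨T, hT, hT'⟩ := ihq
    exact ⟨S + T, hS.add hT, by simpa using (C.thetaGraph ψ).add_mem hS' hT'⟩
  | smul c p _ ihp =>
    obtain ⟨S, hS, hS'⟩ := ihp
    exact ⟨star c • S, hS.smul c, by simpa using (C.thetaGraph ψ).smul_mem (star c) hS'⟩

theorem exists_mem_thetaGraph {S : X →L[ℂ] X} (ψ : X →ₗ[ℂ] B)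
    (hS : S ∈ Submodule.span ℂ {T | ∃ x y, T = C.theta x y}) :
    ∃ b, (S, b) ∈ C.thetaGraph ψ := by
  induction hS using Submodule.span_induction with
  | mem p hp =>
    obtain ⟨x, y, rfl⟩ := hp
    exact ⟨_, Submodule.subset_span ⟨x, y, rfl⟩⟩
  | zero => exact ⟨0, (C.thetaGraph ψ).zero_mem⟩
  | add p q _ _ ihp ihq =>
    obtain ⟨b, hb⟩ := ihp
    obtain ⟨c, hc⟩ := ihq
    exact ⟨b + c, (C.thetaGraph ψ).add_mem hb hc⟩
  | smul c p _ ihp =>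
    obtain ⟨b, hb⟩ := ihp
    exact ⟨c • b, (C.thetaGraph ψ).smul_mem c hb⟩

theorem fst_mem_span_of_mem_thetaGraph {p : (X →L[ℂ] X) × B} (hp : p ∈ C.thetaGraph ψ) :
    p.1 ∈ Submodule.span ℂ {T | ∃ x y, T = C.theta x y} := by
  induction hp using Submodule.span_induction with
  | mem p hp => obtain ⟨x, y, rfl⟩ := hp; exact Submodule.subset_span ⟨x, y, rfl⟩
  | zero => exact Submodule.zero_mem _
  | add p q _ _ ihp ihq => exact Submodule.add_mem _ ihp ihq
  | smul c p _ ihp => exact Submodule.smul_mem _ c ihp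

theorem mul_mem_compacts {S T : X →L[ℂ] X} (hS : S ∈ C.compacts) (hT : T ∈ C.compacts) :
    S * T ∈ C.compacts := by
  refine map_mem_closure₂ continuous_mul hS hT fun S hS T hT => ?_
  -- The second coordinate is irrelevant here: the zero map serves only to obtain an adjoint of `S`.
  obtain ⟨b, hb⟩ := exists_mem_thetaGraph (0 : X →ₗ[ℂ] A) hS
  obtain ⟨U, hU, -⟩ := exists_adjoint_of_mem_thetaGraph hb
  change T ∈ Submodule.span ℂ {T | ∃ x y, T = C.theta x y} at hT
  change S * T ∈ Submodule.span ℂ {T | ∃ x y, T = C.theta x y}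
  induction hT using Submodule.span_induction with
  | mem T hT =>
    obtain ⟨x, y, rfl⟩ := hT
    exact Submodule.subset_span ⟨S x, y, C.mul_theta hU x y⟩
  | zero => rw [mul_zero]; exact zero_mem _
  | add T T' _ _ h h' => rw [mul_add]; exact add_mem h h'
  | smul c T _ h => rw [mul_smul_comm]; exact Submodule.smul_mem _ c h

instance : IsBoundedSMul ℂ C.compacts := 
  NormedSpace.toIsBoundedSMul (𝕜 := ℂ) (E := C.compacts)

namespace IsToeplitzRep

theorem norm_map_le (h : C.IsToeplitzRep ψ π) (x : X) : ‖ψ x‖ ≤ ‖x‖ := by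
  refine le_of_sq_le_sq ?_ (norm_nonneg _)
  rw [sq, ← CStarRing.norm_star_mul_self, h.star_mul, C.norm_sq_eq]
  exact NonUnitalStarAlgHom.norm_apply_le π _

/-- Compatibility with the right action is not an axiom. It follows from the C⋆-identity: the four
terms of `(ψ(x·a) - ψ(x)π(a))⋆ (ψ(x·a) - ψ(x)π(a))` all equal `π(a⋆⟨x, x⟩a)` up to sign and cancel.
-/
theorem map_ract (h : C.IsToeplitzRep ψ π) (x : X) (a : A) : ψ (C.ract x a) = ψ x * π a := by
  rw [← sub_eq_zero, ← norm_eq_zero, ← mul_self_eq_zero, ← CStarRing.norm_star_mul_self,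
    norm_eq_zero]
  have h1 : star (ψ (C.ract x a)) * (ψ x * π a) = π (C.inner (C.ract x a) x * a) := by
    rw [← mul_assoc, h.star_mul, map_mul]
  have h2 : star (ψ x * π a) * ψ (C.ract x a) = π (star a * C.inner x (C.ract x a)) := by
    rw [StarMul.star_mul, mul_assoc, h.star_mul, map_mul, map_star]
  have h3 : star (ψ x * π a) * (ψ x * π a) = π (star a * (C.inner x x * a)) := by
    rw [StarMul.star_mul, mul_assoc, ← mul_assoc (star (ψ x)), h.star_mul, map_mul,
      map_mul, map_star]
  rw [star_sub, sub_mul, mul_sub, mul_sub, h1, h2, h3, h.star_mul, C.inner_ract, C.inner_ract,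
    C.inner_ract_left, mul_assoc]
  simp

theorem mul_map_of_mem_thetaGraph (h : C.IsToeplitzRep ψ π) {p : (X →L[ℂ] X) × B}
    (hp : p ∈ C.thetaGraph ψ) (z : X) : p.2 * ψ z = ψ (p.1 z) := by
  induction hp using Submodule.span_induction with
  | mem p hp =>
    obtain ⟨x, y, rfl⟩ := hp
    rw [mul_assoc, h.star_mul, theta_apply, h.map_ract]
  | zero => simp
  | add p q _ _ ihp ihq => simp [add_mul, ihp, ihq]
  | smul c p _ ihp => simp [smul_mul_assoc, ihp]

theorem mul_mem_thetaGraph (h : C.IsToeplitzRep ψ π) {p q : (X →L[ℂ] X) × B}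
    (hp : p ∈ C.thetaGraph ψ) (hq : q ∈ C.thetaGraph ψ) : p * q ∈ C.thetaGraph ψ := by
  obtain ⟨T, hT, -⟩ := exists_adjoint_of_mem_thetaGraph hp
  induction hq using Submodule.span_induction with
  | mem q hq =>
    obtain ⟨x, y, rfl⟩ := hq
    refine Submodule.subset_span ⟨p.1 x, y, ?_⟩
    rw [← C.mul_theta hT, ← h.mul_map_of_mem_thetaGraph hp, mul_assoc]
    rfl
  | zero => simp
  | add q r _ _ ihq ihr => rw [mul_add]; exact add_mem ihq ihr
  | smul c q _ ihq => rw [mul_smul_comm]; exact Submodule.smul_mem _ c ihq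

/-- Write `q.2` as a finite sum of multiples of elements `ψ(x) ψ(y)⋆`. Then `p.2 ψ(x) = ψ(p.1 x)`
bounds the product by `‖p.1‖` times the sum of the `|c| ‖x‖ ‖y‖`. The constant does not depend on
`p`, so `p` may run through the powers of a fixed element. -/
theorem exists_norm_mul_le (h : C.IsToeplitzRep ψ π) {q : (X →L[ℂ] X) × B}
    (hq : q ∈ C.thetaGraph ψ) :
    ∃ M : ℝ, 0 ≤ M ∧ ∀ p ∈ C.thetaGraph ψ, ‖p.2 * q.2‖ ≤ M * ‖p.1‖ := by
  induction hq using Submodule.span_induction with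
  | mem q hq =>
    obtain ⟨x, y, rfl⟩ := hq
    refine ⟨‖x‖ * ‖y‖, by positivity, fun p hp => ?_⟩
    rw [← mul_assoc, h.mul_map_of_mem_thetaGraph hp]
    calc ‖ψ (p.1 x) * star (ψ y)‖ ≤ ‖ψ (p.1 x)‖ * ‖ψ y‖ :=
          (norm_mul_le _ _).trans_eq (by rw [norm_star])
      _ ≤ (‖p.1‖ * ‖x‖) * ‖y‖ := by
          gcongr
          · exact (h.norm_map_le _).trans (p.1.le_opNorm x)
          · exact h.norm_map_le y
      _ = ‖x‖ * ‖y‖ * ‖p.1‖ := by ring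
  | zero => exact ⟨0, le_rfl, by simp⟩
  | add q r _ _ ihq ihr =>
    obtain ⟨M, hM0, hM⟩ := ihq
    obtain ⟨N, hN0, hN⟩ := ihr
    refine ⟨M + N, by positivity, fun p hp => ?_⟩
    rw [Prod.snd_add, mul_add, add_mul]
    exact (norm_add_le _ _).trans (add_le_add (hM p hp) (hN p hp))
  | smul c q _ ihq =>
    obtain ⟨M, hM0, hM⟩ := ihq
    refine ⟨‖c‖ * M, by positivity, fun p hp => ?_⟩
    rw [Prod.smul_snd, mul_smul_comm, norm_smul, mul_assoc]
    exact mul_le_mul_of_nonneg_left (hM p hp) (norm_nonneg _)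

theorem norm_snd_le_of_isSelfAdjoint (h : C.IsToeplitzRep ψ π) {p : (X →L[ℂ] X) × B}
    (hp : p ∈ C.thetaGraph ψ) (hsa : IsSelfAdjoint p.2) : ‖p.2‖ ≤ ‖p.1‖ := by
  let q : ℕ → (X →L[ℂ] X) × B := fun k => Nat.rec p (fun _ r => r * p) k
  have hq : ∀ k, q k ∈ C.thetaGraph ψ := by
    intro k
    induction k with
    | zero => exact hp
    | succ k ih => exact h.mul_mem_thetaGraph ih hp
  have hq1 : ∀ k, (q k).1 = p.1 ^ (k + 1) := by
    intro k
    induction k with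
    | zero => simp [q]
    | succ k ih => rw [pow_succ _ (k + 1), ← ih]; rfl
  obtain ⟨M, hM0, hM⟩ := h.exists_norm_mul_le hp
  refine norm_le_of_self_adjoint_pow_bound hsa (p := fun k => (q k).2) rfl (fun _ => rfl)
    (M := M) (fun k => ?_) hM0
  rw [← hq1]
  exact hM _ (hq k)

/-- The C⋆-identity reduces this to the self-adjoint element `p.2⋆ p.2`, whose operator is `T p.1`.
In particular `p.1 = 0` forces `p.2 = 0`: the relation is the graph of a bounded map. -/
theorem norm_snd_le (h : C.IsToeplitzRep ψ π) {p : (X →L[ℂ] X) × B}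
    (hp : p ∈ C.thetaGraph ψ) : ‖p.2‖ ≤ √‖C.inner‖ * ‖p.1‖ := by
  obtain ⟨T, hT, hT'⟩ := exists_adjoint_of_mem_thetaGraph hp
  refine le_of_sq_le_sq ?_ (by positivity)
  rw [mul_pow, Real.sq_sqrt (norm_nonneg C.inner), sq ‖p.2‖, ← CStarRing.norm_star_mul_self]
  calc ‖star p.2 * p.2‖ ≤ ‖T * p.1‖ :=
        h.norm_snd_le_of_isSelfAdjoint (h.mul_mem_thetaGraph hT' hp) (IsSelfAdjoint.star_mul_self _)
    _ ≤ ‖T‖ * ‖p.1‖ := norm_mul_le _ _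
    _ ≤ ‖C.inner‖ * ‖p.1‖ * ‖p.1‖ := by gcongr; exact hT.norm_le
    _ = ‖C.inner‖ * ‖p.1‖ ^ 2 := by ring

/-- Every Toeplitz representation induces a homomorphism of `𝒦(X)`. -/
theorem exists_isCompactsHom (h : C.IsToeplitzRep ψ π) :
    ∃ Ψ : C.compacts →L[ℂ] B, C.IsCompactsHom ψ Ψ := by
  -- `ψ⁽¹⁾` is the second projection of the relation, extended along the first projection `e`, whose
  -- range is dense in `𝒦(X)`.
  let f : C.thetaGraph ψ →ₗ[ℂ] B := (LinearMap.snd ℂ _ _).domRestrict (C.thetaGraph ψ)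
  let e : C.thetaGraph ψ →ₗ[ℂ] C.compacts :=
    ((LinearMap.fst ℂ _ _).domRestrict (C.thetaGraph ψ)).codRestrict C.compacts fun p =>
      Submodule.le_topologicalClosure _ (fst_mem_span_of_mem_thetaGraph p.2)
  have he : DenseRange e := fun S => by
    refine C.compacts_induction (p := fun S => S ∈ closure (Set.range e)) isClosed_closure
      (fun S hS => subset_closure ?_) S
    obtain ⟨b, hb⟩ := exists_mem_thetaGraph ψ hS
    exact ⟨⟨_, hb⟩, rfl⟩
  have hfe : ∀ p, ‖f p‖ ≤ √‖C.inner‖ * ‖e p‖ := fun p => h.norm_snd_le p.2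
  set Ψ := f.extendOfNorm e
  have hΨe : ∀ p, Ψ (e p) = f p := LinearMap.extendOfNorm_eq he ⟨_, hfe⟩
  have hΨle : ∀ S, ‖Ψ S‖ ≤ √‖C.inner‖ * ‖S‖ :=
    LinearMap.norm_extendOfNorm_apply_le he _ hfe
  refine ⟨Ψ, ?_, ?_, ?_⟩
  · intro x y
    exact hΨe ⟨(C.theta x y, ψ x * star (ψ y)), Submodule.subset_span ⟨x, y, rfl⟩⟩
  · have hmem : ∀ S T : C.compacts, (S : X →L[ℂ] X) * T ∈ C.compacts := fun S T =>
      mul_mem_compacts S.2 T.2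
    have key : ∀ S T : C.compacts, Ψ ⟨S * T, hmem S T⟩ = Ψ S * Ψ T := fun S T => by
      refine C.compacts_induction (p := fun S => Ψ ⟨S * T, hmem S T⟩ = Ψ S * Ψ T)
        (isClosed_eq (by fun_prop) (by fun_prop)) (fun S hS => ?_) S
      refine C.compacts_induction (p := fun T => Ψ ⟨S * T, hmem S T⟩ = Ψ S * Ψ T)
        (isClosed_eq (by fun_prop) (by fun_prop)) (fun T hT => ?_) T
      obtain ⟨b, hb⟩ := exists_mem_thetaGraph ψ hS
      obtain ⟨c, hc⟩ := exists_mem_thetaGraph ψ hT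
      exact (hΨe ⟨_, h.mul_mem_thetaGraph hb hc⟩).trans
        (congrArg₂ (· * ·) (hΨe ⟨_, hb⟩) (hΨe ⟨_, hc⟩)).symm
    rintro S T ⟨U, hU⟩ rfl
    exact key S T
  · intro S T hST
    have hST : C.IsAdjoint S T := hST
    -- `Ψ` respects adjoints on the relation. Approximating `S` by `e q` approximates `T` by the
    -- adjoint of `e q`, with an error controlled by `‖S - e q‖`; density then gives the bound `0`.
    have hbound : ∀ q : C.thetaGraph ψ,
        ‖Ψ T - star (Ψ S)‖ ≤ (√‖C.inner‖ * ‖C.inner‖ + √‖C.inner‖) * ‖S - e q‖ := fun q => by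
      obtain ⟨U, hU, hU'⟩ := exists_adjoint_of_mem_thetaGraph q.2
      have h1 : Ψ T - star (Ψ S) = Ψ (T - e ⟨_, hU'⟩) - star (Ψ (S - e q)) := by
        rw [map_sub, map_sub, hΨe, hΨe, star_sub]
        change _ = Ψ T - star q.1.2 - (star (Ψ S) - star q.1.2)
        abel
      have h2 : ‖T - e ⟨_, hU'⟩‖ ≤ ‖C.inner‖ * ‖S - e q‖ := (hST.sub hU).norm_le
      rw [h1, add_mul, mul_assoc]
      refine (norm_sub_le _ _).trans (add_le_add ?_ ?_)
      · exact (hΨle _).trans (by gcongr)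
      · rw [norm_star]; exact hΨle _
    refine eq_of_sub_eq_zero (norm_le_zero_iff.1 ?_)
    refine he.induction_on (p := fun R : C.compacts =>
      ‖Ψ T - star (Ψ S)‖ ≤ (√‖C.inner‖ * ‖C.inner‖ + √‖C.inner‖) * ‖S - R‖) S
      (isClosed_le (by fun_prop) (by fun_prop)) hbound |>.trans_eq ?_
    rw [sub_self, show ‖(0 : C.compacts)‖ = 0 from norm_zero (E := X →L[ℂ] X), mul_zero]

/-- Covariance can be checked after composing with a jointly injective family of
homomorphisms. -/
theorem isCovariantRep_of_comp (h : C.IsToeplitzRep ψ π) {I : Type*} {D : I → Type*}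
    [∀ i, NonUnitalCStarAlgebra (D i)] (ι : ∀ i, B →⋆ₙₐ[ℂ] D i)
    (hι : ∀ b, (∀ i, ι i b = 0) → b = 0)
    (hcov : ∀ i, C.IsCovariantRep ((ι i : B →ₗ[ℂ] D i) ∘ₗ ψ) ((ι i).comp π)) :
    C.IsCovariantRep ψ π := by
  obtain ⟨Ψ, hΨ⟩ := h.exists_isCompactsHom
  refine ⟨h, Ψ, hΨ, fun a ha => eq_of_sub_eq_zero (hι _ fun i => ?_)⟩
  obtain ⟨Φ, hΦ, hΦa⟩ := (hcov i).covariant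
  -- The composite of `ι i` with `Ψ` and the given `Φ` agree on rank one operators, hence on `𝒦(X)`,
  -- so covariance of the coordinate applies to `Ψ`.
  have hext : ((ι i : B →ₗ[ℂ] D i).mkContinuous 1 fun b => by
      simpa using NonUnitalStarAlgHom.norm_apply_le (ι i) b).comp Ψ = Φ :=
    C.compacts_hom_ext fun x y => by
      rw [hΦ.map_theta]
      change ι i (Ψ _) = ι i (ψ x) * star (ι i (ψ y))
      rw [hΨ.map_theta, map_mul, map_star]
  rw [map_sub, sub_eq_zero]
  exact (DFunLike.congr_fun hext _).trans (hΦa a ha)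

end IsToeplitzRep

end CompactsHom

end CStarCorrespondence

/-! ### Continuity of homomorphisms and generated C⋆-subalgebras -/

theorem NonUnitalStarAlgHom.continuous_of_cstar {B D : Type*} [NonUnitalCStarAlgebra B]
    [NonUnitalCStarAlgebra D] (φ : B →⋆ₙₐ[ℂ] D) : Continuous φ :=
  AddMonoidHomClass.continuous_of_bound φ 1 fun b => by
    simpa using NonUnitalStarAlgHom.norm_apply_le φ b

theorem subset_generatedCStarAlgebra {X A B : Type*} [NonUnitalCStarAlgebra B] (ψ : X → B)
    (π : A → B) : Set.range ψ ∪ Set.range π ⊆ generatedCStarAlgebra ψ π := fun _ hb =>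
  NonUnitalStarSubalgebra.le_topologicalClosure _ (NonUnitalStarAlgebra.subset_adjoin ℂ _ hb)

theorem isClosed_generatedCStarAlgebra {X A B : Type*} [NonUnitalCStarAlgebra B] (ψ : X → B)
    (π : A → B) : IsClosed (generatedCStarAlgebra ψ π : Set B) :=
  NonUnitalStarSubalgebra.isClosed_topologicalClosure _

/-! ### Existence of the algebra `𝒪_X` -/

/-- Formal expressions in the elements of `G`: sums, products, multiples and adjoints. -/
inductive StarTerm (G : Type*) where
  | of (g : G)
  | zero
  | add (s t : StarTerm G)
  | mul (s t : StarTerm G)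
  | smul (c : ℂ) (t : StarTerm G)
  | star (t : StarTerm G)

namespace StarTerm

variable {G B D : Type*} [NonUnitalCStarAlgebra B] [NonUnitalCStarAlgebra D]

/-- The value of an expression, for given values of the generators. -/
def eval (γ : G → B) : StarTerm G → B
  | of g => γ g
  | zero => 0
  | add s t => eval γ s + eval γ t
  | mul s t => eval γ s * eval γ t
  | smul c t => c • eval γ t
  | star t => Star.star (eval γ t)

theorem map_eval (h : B →⋆ₙₐ[ℂ] D) (γ : G → B) (t : StarTerm G) :
    h (t.eval γ) = t.eval (h ∘ γ) := by
  induction t with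
  | of g => rfl
  | zero => exact map_zero h
  | add s t hs ht => simp only [eval, map_add, hs, ht]
  | mul s t hs ht => simp only [eval, map_mul, hs, ht]
  | smul c t ht => simp only [eval, map_smul, ht]
  | star t ht => simp only [eval, map_star, ht]

theorem exists_eval_eq {γ : G → B} {b : B} (hb : b ∈ NonUnitalStarAlgebra.adjoin ℂ (Set.range γ)) :
    ∃ t : StarTerm G, t.eval γ = b := by
  induction hb using NonUnitalStarAlgebra.adjoin_induction with
  | mem x hx => obtain ⟨g, rfl⟩ := hx; exact ⟨of g, rfl⟩
  | add x y _ _ hx hy =>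
    obtain ⟨s, rfl⟩ := hx
    obtain ⟨t, rfl⟩ := hy
    exact ⟨add s t, rfl⟩
  | zero => exact ⟨zero, rfl⟩
  | mul x y _ _ hx hy =>
    obtain ⟨s, rfl⟩ := hx
    obtain ⟨t, rfl⟩ := hy
    exact ⟨mul s t, rfl⟩
  | smul c x _ hx => obtain ⟨t, rfl⟩ := hx; exact ⟨smul c t, rfl⟩
  | star x _ hx => obtain ⟨t, rfl⟩ := hx; exact ⟨star t, rfl⟩

end StarTerm

/-- A homomorphism of C⋆-algebras with prescribed values on a generating family. -/
theorem exists_starHom_of_norm_eval_le {G B D : Type*} [NonUnitalCStarAlgebra B]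
    [NonUnitalCStarAlgebra D] {γ : G → B} {δ : G → D}
    (hγ : (NonUnitalStarAlgebra.adjoin ℂ (Set.range γ)).topologicalClosure = ⊤)
    (h : ∀ t : StarTerm G, ‖t.eval δ‖ ≤ ‖t.eval γ‖) :
    ∃ φ : B →⋆ₙₐ[ℂ] D, ∀ g, φ (γ g) = δ g := by
  -- `P` is to be the graph of `φ`. The norm hypothesis makes the first projection isometric on `P`,
  -- so its range is closed; as it contains the generators, the projection is bijective, and `φ` is
  -- its inverse followed by the second projection.
  let P : NonUnitalStarSubalgebra ℂ (B × D) :=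
    (NonUnitalStarAlgebra.adjoin ℂ (Set.range fun g => (γ g, δ g))).topologicalClosure
  have hPc : IsClosed (P : Set (B × D)) := NonUnitalStarSubalgebra.isClosed_topologicalClosure _
  have hγP : ∀ g, (γ g, δ g) ∈ P := fun g =>
    NonUnitalStarSubalgebra.le_topologicalClosure _
      (NonUnitalStarAlgebra.subset_adjoin ℂ _ ⟨g, rfl⟩)
  have hP : ∀ p ∈ P, ‖p.2‖ ≤ ‖p.1‖ := by
    intro p hp
    refine closure_minimal (t := {p : B × D | ‖p.2‖ ≤ ‖p.1‖}) (fun q hq => ?_)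
      (isClosed_le (by fun_prop) (by fun_prop)) hp
    obtain ⟨t, rfl⟩ := StarTerm.exists_eval_eq hq
    have h1 := StarTerm.map_eval (NonUnitalStarAlgHom.fst ℂ B D) (fun g => (γ g, δ g)) t
    have h2 := StarTerm.map_eval (NonUnitalStarAlgHom.snd ℂ B D) (fun g => (γ g, δ g)) t
    change ‖NonUnitalStarAlgHom.snd ℂ B D _‖ ≤ ‖NonUnitalStarAlgHom.fst ℂ B D _‖
    rw [h1, h2]
    exact h t
  let fst : P →⋆ₙₐ[ℂ] B :=
    (NonUnitalStarAlgHom.fst ℂ B D).comp (NonUnitalStarSubalgebraClass.subtype P)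
  have hfst : ∀ p, ‖fst p‖ = ‖p‖ := fun p => (max_eq_left (hP p.1 p.2)).symm
  have hiso : Isometry fst := AddMonoidHomClass.isometry_of_norm fst hfst
  have : CompleteSpace P := hPc.completeSpace_coe
  have hsurj : Function.Surjective fst := by
    have hle : (NonUnitalStarAlgebra.adjoin ℂ (Set.range γ)).topologicalClosure ≤
        NonUnitalStarAlgHom.range fst := by
      refine NonUnitalStarSubalgebra.topologicalClosure_minimal _
        (NonUnitalStarAlgebra.adjoin_le ?_) ?_
      · rintro _ ⟨g, rfl⟩
        exact ⟨⟨_, hγP g⟩, rfl⟩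
      · have := hiso.isClosedEmbedding.isClosed_range
        simpa using this
    intro b
    have hb : b ∈ (⊤ : NonUnitalStarSubalgebra ℂ B) := trivial
    rw [← hγ] at hb
    exact hle hb
  let e : P ≃⋆ₐ[ℂ] B := StarAlgEquiv.ofBijective fst ⟨hiso.injective, hsurj⟩
  refine ⟨((NonUnitalStarAlgHom.snd ℂ B D).comp (NonUnitalStarSubalgebraClass.subtype P)).comp
    (e.symm : B →⋆ₙₐ[ℂ] P), fun g => ?_⟩
  have he : e.symm (γ g) = ⟨_, hγP g⟩ := by
    rw [StarAlgEquiv.symm_apply_eq]; rfl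
  change (e.symm (γ g)).1.2 = δ g
  rw [he]

/-! ### Bounded products of C⋆-algebras -/

section Product

open scoped ENNReal

variable {I : Type*} {D : I → Type*} [∀ i, NonUnitalCStarAlgebra (D i)]

/-- The coordinate homomorphisms of a bounded product of C⋆-algebras. -/
def lpInftyEval (i : I) : lp D ∞ →⋆ₙₐ[ℂ] D i where
  toFun f := f i
  map_smul' _ _ := rfl
  map_zero' := rfl
  map_add' _ _ := rfl
  map_mul' _ _ := rfl
  map_star' _ := rfl

/-- The map into a bounded product with given coordinates. -/
def lpInftyLift {X : Type*} [AddCommGroup X] [Module ℂ X] (f : ∀ i, X →ₗ[ℂ] D i)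
    (hf : ∀ x, BddAbove (Set.range fun i => ‖f i x‖)) : X →ₗ[ℂ] lp D ∞ where
  toFun x := ⟨fun i => f i x, memℓp_infty (hf x)⟩
  map_add' x y := by ext i; exact map_add (f i) x y
  map_smul' c x := by ext i; exact map_smul (f i) c x

/-- The homomorphism into a bounded product with given coordinates. -/
def lpInftyLiftHom {A : Type*} [NonUnitalCStarAlgebra A] (f : ∀ i, A →⋆ₙₐ[ℂ] D i) :
    A →⋆ₙₐ[ℂ] lp D ∞ where
  toFun a := ⟨fun i => f i a, memℓp_infty ⟨‖a‖, by
    rintro _ ⟨i, rfl⟩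
    exact NonUnitalStarAlgHom.norm_apply_le (f i) a⟩⟩
  map_smul' c a := by ext i; exact map_smul (f i) c a
  map_zero' := by ext i; exact map_zero (f i)
  map_add' a b := by ext i; exact map_add (f i) a b
  map_mul' a b := by ext i; exact map_mul (f i) a b
  map_star' a := by ext i; exact map_star (f i) a

end Product

namespace CStarCorrespondence

theorem isToeplitzRep_of_comp {A X B : Type*} [NonUnitalCStarAlgebra A] [NormedAddCommGroup X]
    [NormedSpace ℂ X] [CompleteSpace X] [NonUnitalCStarAlgebra B] {C : CStarCorrespondence A X}
    {ψ : X →ₗ[ℂ] B} {π : A →⋆ₙₐ[ℂ] B} {I : Type*} {D : I → Type*}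
    [∀ i, NonUnitalCStarAlgebra (D i)] (ι : ∀ i, B →⋆ₙₐ[ℂ] D i)
    (hι : ∀ b, (∀ i, ι i b = 0) → b = 0)
    (h : ∀ i, C.IsToeplitzRep ((ι i : B →ₗ[ℂ] D i) ∘ₗ ψ) ((ι i).comp π)) :
    C.IsToeplitzRep ψ π where
  map_lact a x := eq_of_sub_eq_zero <| hι _ fun i => by
    rw [map_sub, sub_eq_zero, map_mul]
    exact (h i).map_lact a x
  star_mul x y := eq_of_sub_eq_zero <| hι _ fun i => by
    rw [map_sub, sub_eq_zero, map_mul, map_star]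
    exact (h i).star_mul x y

open scoped ENNReal in
/-- The C⋆-algebra `𝒪_X` exists. -/
theorem exists_isCuntzPimsnerAlgebra {A : Type u} {X : Type v} [NonUnitalCStarAlgebra A]
    [NormedAddCommGroup X] [NormedSpace ℂ X] [CompleteSpace X] (C : CStarCorrespondence A X) :
    ∃ (O : Type (max u v w)) (_ : NonUnitalCStarAlgebra O) (ψ : X →ₗ[ℂ] O) (π : A →⋆ₙₐ[ℂ] O),
      C.IsCuntzPimsnerAlgebra ψ π := by
  -- all covariant representations, up to the norms of the values of expressions
  let I : Type (max u v) := {N : StarTerm (X ⊕ A) → ℝ // ∃ (D : Type (max u v w))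
    (_ : NonUnitalCStarAlgebra D) (ψ : X →ₗ[ℂ] D) (π : A →⋆ₙₐ[ℂ] D),
    C.IsCovariantRep ψ π ∧ ∀ t, N t = ‖t.eval (Sum.elim ψ π)‖}
  -- The index set consists of functions on expressions, so it is small: the product of one chosen
  -- algebra per index stays in the universe over which universality quantifies.
  let D : I → Type (max u v w) := fun i => i.2.choose
  let _ : ∀ i, NonUnitalCStarAlgebra (D i) := fun i => i.2.choose_spec.choose
  let ψ : ∀ i, X →ₗ[ℂ] D i := fun i => i.2.choose_spec.choose_spec.choose
  let π : ∀ i, A →⋆ₙₐ[ℂ] D i := fun i => i.2.choose_spec.choose_spec.choose_spec.choose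
  have hcov : ∀ i, C.IsCovariantRep (ψ i) (π i) := fun i =>
    i.2.choose_spec.choose_spec.choose_spec.choose_spec.1
  have hnorm : ∀ (i : I) (t : StarTerm (X ⊕ A)),
      i.1 t = ‖t.eval (Sum.elim (ψ i) (π i))‖ := fun i =>
    i.2.choose_spec.choose_spec.choose_spec.choose_spec.2
  let Ψ : X →ₗ[ℂ] lp D ∞ := lpInftyLift ψ fun x => ⟨‖x‖, by
    rintro _ ⟨i, rfl⟩
    exact (hcov i).norm_map_le x⟩
  let Λ : A →⋆ₙₐ[ℂ] lp D ∞ := lpInftyLiftHom π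
  let S := generatedCStarAlgebra Ψ Λ
  have hS : IsClosed (S : Set (lp D ∞)) := isClosed_generatedCStarAlgebra _ _
  have hsub : Set.range Ψ ∪ Set.range Λ ⊆ S := subset_generatedCStarAlgebra _ _
  have hΨS : ∀ x, Ψ x ∈ S := fun x => hsub (Or.inl ⟨x, rfl⟩)
  have hΛS : ∀ a, Λ a ∈ S := fun a => hsub (Or.inr ⟨a, rfl⟩)
  let _ : NonUnitalCStarAlgebra S := NonUnitalStarSubalgebra.nonUnitalCStarAlgebra S
  let j : X →ₗ[ℂ] S :=
    { toFun := fun x => ⟨Ψ x, hΨS x⟩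
      map_add' := fun x y => Subtype.ext (map_add Ψ x y)
      map_smul' := fun c x => Subtype.ext (map_smul Ψ c x) }
  let k : A →⋆ₙₐ[ℂ] S := NonUnitalStarAlgHom.codRestrict Λ S hΛS
  let ι : ∀ i, S →⋆ₙₐ[ℂ] D i := fun i =>
    (lpInftyEval i).comp (NonUnitalStarSubalgebraClass.subtype S)
  have hι : ∀ b, (∀ i, ι i b = 0) → b = 0 := fun b hb => by
    apply Subtype.ext
    ext i
    exact hb i
  have hjk : C.IsCovariantRep j k :=
    (isToeplitzRep_of_comp ι hι fun i => (hcov i).toIsToeplitzRep).isCovariantRep_of_comp ι hι hcov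
  have hgen : generatedCStarAlgebra j k = ⊤ := by
    have hle : S ≤ (generatedCStarAlgebra j k).map (NonUnitalStarSubalgebraClass.subtype S) := by
      refine NonUnitalStarSubalgebra.topologicalClosure_minimal _
        (NonUnitalStarAlgebra.adjoin_le ?_) ?_
      · rintro _ (⟨x, rfl⟩ | ⟨a, rfl⟩)
        · exact ⟨j x, subset_generatedCStarAlgebra j k (Or.inl ⟨x, rfl⟩), rfl⟩
        · exact ⟨k a, subset_generatedCStarAlgebra j k (Or.inr ⟨a, rfl⟩), rfl⟩
      · exact hS.isClosedEmbedding_subtypeVal.isClosedMap _ (isClosed_generatedCStarAlgebra j k)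
    refine eq_top_iff.2 fun b _ => ?_
    obtain ⟨c, hc, hcb⟩ := hle b.2
    rwa [← Subtype.ext hcb]
  refine ⟨S, inferInstance, j, k, hjk, fun D' _ ψ' π' h' => ?_, hgen⟩
  -- The algebra chosen at this index need not be `D'`, but expressions have the same norms in both.
  -- Those norms are at most the norms in `S`, which is all that is needed to define a homomorphism
  -- from `S` to `D'`.
  let i : I := ⟨fun t => ‖t.eval (Sum.elim ψ' π')‖, D', inferInstance, ψ', π', h', fun _ => rfl⟩
  have hgen' :
      (NonUnitalStarAlgebra.adjoin ℂ (Set.range (Sum.elim j k))).topologicalClosure = ⊤ := by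
    rw [Set.Sum.elim_range]; exact hgen
  obtain ⟨φ, hφ⟩ := exists_starHom_of_norm_eval_le (δ := Sum.elim ψ' π') hgen' fun t => by
    have h1 : ‖t.eval (Sum.elim ψ' π')‖ = ‖t.eval (Sum.elim (ψ i) (π i))‖ := hnorm i t
    have h2 : ι i ∘ Sum.elim j k = Sum.elim (ψ i) (π i) := by
      ext (x | a) <;> rfl
    rw [h1, ← h2, ← StarTerm.map_eval]
    exact NonUnitalStarAlgHom.norm_apply_le (ι i) _
  exact ⟨φ, fun x => hφ (Sum.inl x), fun a => hφ (Sum.inr a)⟩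

end CStarCorrespondence

/-! ### Toeplitz representations of a topological graph and of its correspondence -/

section Localization

variable {Y : Type*} [TopologicalSpace Y]

theorem tsupport_add_subset (x y : C_c(Y, ℂ)) : tsupport (x + y) ⊆ tsupport x ∪ tsupport y := by
  refine closure_minimal (fun e he => ?_)
    ((isClosed_tsupport _).union (isClosed_tsupport _))
  by_contra hcon
  rw [Set.mem_union, not_or] at hcon
  refine he ?_
  change x e + y e = 0
  rw [image_eq_zero_of_notMem_tsupport hcon.1, image_eq_zero_of_notMem_tsupport hcon.2, add_zero]

theorem tsupport_smul_subset (c : ℂ) (x : C_c(Y, ℂ)) : tsupport (c • x) ⊆ tsupport x :=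
  closure_mono fun e he h0 => he (by change c * x e = 0; rw [h0, mul_zero])

/-- An additive property of functions with compact support holds if it holds locally. -/
theorem CompactlySupportedContinuousMap.induction_local [LocallyCompactSpace Y] [T2Space Y]
    {P : C_c(Y, ℂ) → Prop} (zero : P 0) (add : ∀ x y, P x → P y → P (x + y))
    (loc : ∀ e, ∃ U : Set Y, IsOpen U ∧ e ∈ U ∧ ∀ x : C_c(Y, ℂ), tsupport x ⊆ U → P x)
    (x : C_c(Y, ℂ)) : P x := by
  choose U hU heU hPU using loc
  have hx : IsCompact (tsupport x) := x.hasCompactSupport'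
  obtain ⟨t, ht⟩ := hx.elim_finite_subcover U hU
    fun e _ => Set.mem_iUnion.2 ⟨e, heU e⟩
  have ht' : tsupport x ⊆ ⋃ i : Fin t.card, U (t.equivFin.symm i) := fun e he => by
    obtain ⟨i, hi, hei⟩ := Set.mem_iUnion₂.1 (ht he)
    exact Set.mem_iUnion.2 ⟨t.equivFin ⟨i, hi⟩, by simpa using hei⟩
  obtain ⟨g, hg, hg1, -, -⟩ := exists_continuous_sum_one_of_isOpen_isCompact
    (fun i => hU (t.equivFin.symm i : Y)) x.hasCompactSupport' ht'
  let y : Fin t.card → C_c(Y, ℂ) := fun i =>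
    { toFun := fun e => (g i e : ℂ) * x e
      continuous_toFun := by fun_prop
      hasCompactSupport' := x.hasCompactSupport'.mul_left }
  have hy : ∀ i, P (y i) := fun i => hPU _ _ <| by
    have hsub : Function.support (y i) ⊆ Function.support (g i) := fun e he h0 => he <| by
      change (g i e : ℂ) * x e = 0
      rw [h0, Complex.ofReal_zero, zero_mul]
    exact (closure_mono hsub).trans (hg i)
  have hsum : x = ∑ i, y i := by
    ext e
    rw [CompactlySupportedContinuousMap.sum_apply]
    change x e = ∑ i, (g i e : ℂ) * x e
    rw [← Finset.sum_mul, ← Complex.ofReal_sum]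
    by_cases he : e ∈ tsupport x
    · have h1 : ∑ i, g i e = 1 := by simpa using hg1 he
      rw [h1, Complex.ofReal_one, one_mul]
    · rw [image_eq_zero_of_notMem_tsupport he, mul_zero]
  rw [hsum]
  exact Finset.sum_induction _ P add zero fun i _ => hy i

end Localization

namespace TopologicalGraph

variable {E₀ : Type u} {E₁ : Type v} [TopologicalSpace E₀] [TopologicalSpace E₁]
  [T2Space E₀] [T2Space E₁] (E : TopologicalGraph E₀ E₁)

variable {E} in
theorem IsSSection.mono {U V : Set E₁} (hU : E.IsSSection U) (h : V ⊆ U) : E.IsSSection V :=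
  Topology.IsEmbedding.comp (f := Set.inclusion h) (g := U.domRestrict E.s) hU
    (Topology.IsEmbedding.inclusion h)

variable {E} in
theorem IsSSection.injOn {U : Set E₁} (hU : E.IsSSection U) : Set.InjOn E.s U :=
  fun _ ha _ hb h => congrArg Subtype.val (@hU.injective ⟨_, ha⟩ ⟨_, hb⟩ h)

theorem exists_isSSection (e : E₁) : ∃ U : Set E₁, IsOpen U ∧ e ∈ U ∧ E.IsSSection U := by
  obtain ⟨φ, he, hφ⟩ := E.isLocalHomeomorph_s e
  refine ⟨φ.source, φ.open_source, he, ?_⟩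
  have := φ.isOpenEmbedding_restrict.isEmbedding
  rwa [← hφ] at this

theorem isHat_unique {x : C_c(E₁, ℂ)} {f g : C₀(E₀, ℂ)} (hf : E.IsHat x f) (hg : E.IsHat x g) :
    f = g := by
  ext v
  by_cases hv : v ∈ E.s '' Function.support x
  · obtain ⟨e, he, rfl⟩ := hv
    rw [hf.1 e he, hg.1 e he]
  · rw [hf.2 v hv, hg.2 v hv]

theorem innerCc_eq_zero_of_disjoint {x y : C_c(E₁, ℂ)}
    (h : Disjoint (Function.support x) (Function.support y)) : E.innerCc x y = 0 := by
  ext v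
  rw [innerCc_apply]
  refine finsum_mem_eq_zero_of_forall_eq_zero fun e _ => ?_
  by_cases hx : x e = 0
  · rw [hx, star_zero, zero_mul]
  · have hy : y e = 0 := by
      by_contra hy
      exact Set.disjoint_left.1 h hx hy
    rw [hy, mul_zero]

theorem corrInner_toCorr (x y : C_c(E₁, ℂ)) :
    E.graphCorr.inner (E.toCorr x) (E.toCorr y) = E.innerCc x y :=
  E.corrInner_coe (PreCorr.of E x) (PreCorr.of E y)

theorem corrLact_toCorr (f : C₀(E₀, ℂ)) (x : C_c(E₁, ℂ)) :
    E.graphCorr.lact f (E.toCorr x) = E.toCorr (E.lmul f x) :=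
  E.corrLact_coe f (PreCorr.of E x)

theorem corrRact_toCorr (x : C_c(E₁, ℂ)) (f : C₀(E₀, ℂ)) :
    E.graphCorr.ract (E.toCorr x) f = E.toCorr (E.rmul x f) :=
  E.corrRact_coe (PreCorr.of E x) f

theorem denseRange_toCorr : DenseRange E.toCorr :=
  UniformSpace.Completion.denseRange_coe (α := E.PreCorr)

section Representations

variable {B : Type*} [NonUnitalCStarAlgebra B] {π : C₀(E₀, ℂ) →⋆ₙₐ[ℂ] B}

variable {E} in
theorem isToeplitzRep_comp_toCorr {ψ : E.CorrSpace →ₗ[ℂ] B}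
    (h : E.graphCorr.IsToeplitzRep ψ π) : E.IsToeplitzRep (ψ ∘ₗ E.toCorr) π where
  map_lmul f x := by
    rw [LinearMap.comp_apply, ← E.corrLact_toCorr]
    exact h.map_lact f _
  map_hat x U _ hU hx g hg := by
    rw [LinearMap.comp_apply, h.star_mul, E.corrInner_toCorr,
      E.isHat_unique hg (E.isHat_innerCc (hU.mono ((subset_tsupport _).trans hx)))]
  orthogonal x y U W _ _ _ _ hUW hx hy := by
    rw [LinearMap.comp_apply, LinearMap.comp_apply, h.star_mul, E.corrInner_toCorr,
      E.innerCc_eq_zero_of_disjoint, map_zero]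
    exact hUW.mono ((subset_tsupport _).trans hx) ((subset_tsupport _).trans hy)

variable {E} {ψ : C_c(E₁, ℂ) →ₗ[ℂ] B}

/-- Polarization: `x + y` and `x + i y` are again supported in `U`, where condition (2) gives the
identity on the diagonal. -/
theorem IsToeplitzRep.star_mul_of_subset (h : E.IsToeplitzRep ψ π) {x y : C_c(E₁, ℂ)}
    {U : Set E₁} (hU : IsOpen U) (hUs : E.IsSSection U) (hx : tsupport x ⊆ U)
    (hy : tsupport y ⊆ U) : star (ψ x) * ψ y = π (E.innerCc x y) := by
  have hq : ∀ z : C_c(E₁, ℂ), tsupport z ⊆ U → star (ψ z) * ψ z = π (E.innerCc z z) := fun z hz =>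
    (h.map_hat z U hU hUs hz _ (E.isHat_innerCc (hUs.mono ((subset_tsupport _).trans hz)))).symm
  have h1 := hq (x + y) ((tsupport_add_subset x y).trans (Set.union_subset hx hy))
  have h2 := hq (x + Complex.I • y) ((tsupport_add_subset x _).trans
    (Set.union_subset hx ((tsupport_smul_subset _ y).trans hy)))
  simp only [map_add, star_add, add_mul, mul_add, innerCc_add_left, innerCc_add_right, map_smul,
    star_smul, smul_mul_assoc, mul_smul_comm, innerCc_smul_left, innerCc_smul_right, hq x hx,
    hq y hy] at h1 h2
  set a := star (ψ x) * ψ y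
  set b := star (ψ y) * ψ x
  -- The errors `d` and `d'` at `(x, y)` and `(y, x)` satisfy `d + d' = 0` and `i (d - d') = 0`, so
  -- `2 d = 0`.
  have h3 : (a - π (E.innerCc x y)) + (b - π (E.innerCc y x)) = 0 := by
    rw [← sub_eq_zero] at h1
    rw [← h1]; abel
  have h4 : Complex.I • (a - π (E.innerCc x y)) - Complex.I • (b - π (E.innerCc y x)) = 0 := by
    rw [← sub_eq_zero] at h2
    rw [← h2]
    simp only [Complex.star_def, Complex.conj_I, smul_sub, smul_add, neg_smul]
    abel
  rw [← smul_sub, smul_eq_zero_iff_right Complex.I_ne_zero] at h4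
  have h5 : (2 : ℂ) • (a - π (E.innerCc x y)) = 0 := by
    rw [two_smul, ← add_zero 0]
    nth_rw 1 [← h3]
    nth_rw 1 [← h4]
    abel
  exact sub_eq_zero.1 ((smul_eq_zero_iff_right two_ne_zero).1 h5)

/-- Both sides are additive in each variable, so only functions supported near given points `e`,
`e'` matter. If `e = e'` a common section allows polarization; otherwise disjoint sections make both
sides vanish. -/
theorem IsToeplitzRep.star_mul [LocallyCompactSpace E₁] (h : E.IsToeplitzRep ψ π)
    (x y : C_c(E₁, ℂ)) : star (ψ x) * ψ y = π (E.innerCc x y) := by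
  have hloc : ∀ e e' : E₁, ∃ V W : Set E₁, IsOpen V ∧ e ∈ V ∧ IsOpen W ∧ e' ∈ W ∧
      ∀ x y : C_c(E₁, ℂ), tsupport x ⊆ V → tsupport y ⊆ W →
        star (ψ x) * ψ y = π (E.innerCc x y) := by
    intro e e'
    obtain ⟨V, hV, heV, hVs⟩ := E.exists_isSSection e
    by_cases hee : e = e'
    · subst hee
      exact ⟨V, V, hV, heV, hV, heV, fun x y hx hy => h.star_mul_of_subset hV hVs hx hy⟩
    · obtain ⟨W, hW, heW, hWs⟩ := E.exists_isSSection e'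
      obtain ⟨V', W', hV', hW', heV', heW', hd⟩ := t2_separation hee
      refine ⟨V ∩ V', W ∩ W', hV.inter hV', ⟨heV, heV'⟩, hW.inter hW', ⟨heW, heW'⟩,
        fun x y hx hy => ?_⟩
      have hd' : Disjoint (V ∩ V') (W ∩ W') :=
        hd.mono Set.inter_subset_right Set.inter_subset_right
      rw [h.orthogonal x y _ _ (hV.inter hV') (hW.inter hW') (hVs.mono Set.inter_subset_left)
        (hWs.mono Set.inter_subset_left) hd' hx hy, E.innerCc_eq_zero_of_disjoint, map_zero]
      exact hd'.mono ((subset_tsupport _).trans hx) ((subset_tsupport _).trans hy)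
  have hzero : ∀ x : C_c(E₁, ℂ), E.innerCc x 0 = 0 := fun x => by
    simpa using E.innerCc_smul_right 0 x 0
  have hzero' : ∀ x : C_c(E₁, ℂ), E.innerCc 0 x = 0 := fun x => by
    rw [← E.star_innerCc, hzero, star_zero]
  refine x.induction_local (P := fun x => star (ψ x) * ψ y = π (E.innerCc x y)) ?_ ?_ ?_
  · simp [hzero']
  · intro x x' hx hx'
    rw [map_add, star_add, add_mul, hx, hx', innerCc_add_left, map_add]
  intro e
  -- The neighbourhood of `e` may depend on `y`; when two functions `y` are added, the
  -- neighbourhoods are intersected.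
  refine y.induction_local (P := fun y => ∃ U : Set E₁, IsOpen U ∧ e ∈ U ∧
    ∀ x : C_c(E₁, ℂ), tsupport x ⊆ U → star (ψ x) * ψ y = π (E.innerCc x y)) ?_ ?_ ?_
  · exact ⟨Set.univ, isOpen_univ, trivial, fun x _ => by simp [hzero]⟩
  · rintro y y' ⟨U, hU, heU, hy⟩ ⟨U', hU', heU', hy'⟩
    refine ⟨U ∩ U', hU.inter hU', ⟨heU, heU'⟩, fun x hx => ?_⟩
    rw [map_add, mul_add, hy x (hx.trans Set.inter_subset_left),
      hy' x (hx.trans Set.inter_subset_right), innerCc_add_right, map_add]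
  · intro e'
    obtain ⟨V, W, hV, heV, hW, heW, hVW⟩ := hloc e e'
    exact ⟨W, hW, heW, fun y hy => ⟨V, hV, heV, fun x hx => hVW x y hx hy⟩⟩

/-- A Toeplitz representation of `E` extends to a Toeplitz representation of `X(E)`. -/
theorem IsToeplitzRep.exists_extension [LocallyCompactSpace E₁] (h : E.IsToeplitzRep ψ π) :
    ∃ ψ' : E.CorrSpace →ₗ[ℂ] B, ψ' ∘ₗ E.toCorr = ψ ∧ E.graphCorr.IsToeplitzRep ψ' π := by
  have hle : ∀ x : E.PreCorr, ‖(ψ ∘ₗ (PreCorr.of E).symm.toLinearMap) x‖ ≤ 1 * ‖x‖ := by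
    intro x
    refine le_of_sq_le_sq ?_ (by positivity)
    rw [one_mul, PreCorr.norm_def, Real.sq_sqrt (norm_nonneg _), sq,
      ← CStarRing.norm_star_mul_self]
    change ‖star (ψ ((PreCorr.of E).symm x)) * ψ ((PreCorr.of E).symm x)‖ ≤ _
    rw [h.star_mul]
    exact NonUnitalStarAlgHom.norm_apply_le π _
  let Ψ : E.CorrSpace →L[ℂ] B := extendToCompletion (ψ ∘ₗ (PreCorr.of E).symm.toLinearMap)
  have hΨ : ∀ x, Ψ (E.toCorr x) = ψ x := fun x => extendToCompletion_coe hle (PreCorr.of E x)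
  have hπ : Continuous π := π.continuous_of_cstar
  refine ⟨Ψ, LinearMap.ext hΨ, ⟨fun f x => ?_, fun x y => ?_⟩⟩
  · refine E.denseRange_toCorr.induction_on
      (p := fun x => Ψ (E.graphCorr.lact f x) = π f * Ψ x) x
      (isClosed_eq (by fun_prop) (by fun_prop)) fun x => ?_
    rw [E.corrLact_toCorr, hΨ, hΨ, h.map_lmul]
  · refine E.denseRange_toCorr.induction_on₂
      (p := fun x y => star (Ψ x) * Ψ y = π (E.graphCorr.inner x y))
      (isClosed_eq (by fun_prop) (hπ.comp (by fun_prop))) (fun x y => ?_) x y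
    rw [hΨ, hΨ, E.corrInner_toCorr, h.star_mul]

end Representations

end TopologicalGraph

/-! ### Functions vanishing off a given set -/

section VanishingOff

open scoped ComplexOrder

variable {Y : Type*} [TopologicalSpace Y]

theorem ZeroAtInftyContinuousMap.continuous_eval_const (v : Y) :
    Continuous fun f : C₀(Y, ℂ) => f v :=
  (BoundedContinuousFunction.lipschitz_eval_const v).continuous.comp
    ZeroAtInftyContinuousMap.isometry_toBCF.continuous

theorem ZeroAtInftyContinuousMap.isCompact_norm_ge (f : C₀(Y, ℂ)) {ε : ℝ} (hε : 0 < ε) :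
    IsCompact {v | ε ≤ ‖f v‖} := by
  have h1 : ∀ᶠ v in Filter.cocompact Y, ‖f v‖ < ε := by
    have := f.zero_at_infty'.norm
    rw [norm_zero] at this
    exact this.eventually_lt_const hε
  obtain ⟨K, hK, hKf⟩ := Filter.mem_cocompact.1 h1
  refine hK.of_isClosed_subset (isClosed_le continuous_const f.continuous.norm) fun v hv => ?_
  by_contra hvK
  have h2 : ‖f v‖ < ε := hKf hvK
  have h3 : ε ≤ ‖f v‖ := hv
  exact h2.not_ge h3

/-- The function `(Re(θ f) - ε)⁺`. -/
def cutoff (f : C₀(Y, ℂ)) (θ : ℂ) (ε : ℝ) (hε : 0 ≤ ε) : C₀(Y, ℂ) where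
  toFun v := ((max ((θ * f v).re - ε) 0 : ℝ) : ℂ)
  continuous_toFun := by fun_prop
  zero_at_infty' := by
    have hc : Continuous fun z : ℂ => ((max ((θ * z).re - ε) 0 : ℝ) : ℂ) := by fun_prop
    have := (hc.tendsto 0).comp f.zero_at_infty'
    simpa [Function.comp_def, max_eq_right (neg_nonpos.2 hε)] using this

theorem cutoff_apply (f : C₀(Y, ℂ)) (θ : ℂ) {ε : ℝ} (hε : 0 ≤ ε) (v : Y) :
    cutoff f θ ε hε v = ((max ((θ * f v).re - ε) 0 : ℝ) : ℂ) := rfl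

theorem tsupport_cutoff_subset (f : C₀(Y, ℂ)) {θ : ℂ} (hθ : ‖θ‖ = 1) {ε : ℝ} (hε : 0 ≤ ε) :
    tsupport (cutoff f θ ε hε) ⊆ {v | ε ≤ ‖f v‖} := by
  refine closure_minimal (fun v hv => ?_) (isClosed_le continuous_const f.continuous.norm)
  by_contra hlt
  refine hv ?_
  rw [cutoff_apply, max_eq_right, Complex.ofReal_zero]
  have h1 : (θ * f v).re ≤ ‖f v‖ := by
    simpa [hθ] using Complex.re_le_norm (θ * f v)
  have h2 : ‖f v‖ < ε := not_le.1 hlt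
  linarith

/-- The difference is `t` clipped to `[-ε, ε]`. -/
theorem abs_sub_cut_le (t : ℝ) {ε : ℝ} (hε : 0 ≤ ε) :
    |t - (max (t - ε) 0 - max (-t - ε) 0)| ≤ ε := by
  rw [abs_le]
  rcases max_cases (t - ε) 0 with ⟨h1, h1'⟩ | ⟨h1, h1'⟩ <;>
    rcases max_cases (-t - ε) 0 with ⟨h2, h2'⟩ | ⟨h2, h2'⟩ <;> rw [h1, h2] <;>
    constructor <;> linarith

/-- With `θ = 1, -1, -i, i` the real part of `θ f` is `Re f`, `-Re f`, `Im f`, `-Im f`. The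
combination therefore moves the real and the imaginary part by at most `ε` each. -/
theorem norm_sub_cutoff_le (f : C₀(Y, ℂ)) {ε : ℝ} (hε : 0 ≤ ε) :
    ‖f - (cutoff f 1 ε hε - cutoff f (-1) ε hε + Complex.I •
      (cutoff f (-Complex.I) ε hε - cutoff f Complex.I ε hε))‖ ≤ 2 * ε := by
  rw [← ZeroAtInftyContinuousMap.norm_toBCF_eq_norm]
  refine (BoundedContinuousFunction.norm_le (by positivity)).2 fun v => ?_
  refine (Complex.norm_le_abs_re_add_abs_im _).trans ?_
  have h1 := abs_sub_cut_le (f v).re hε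
  have h2 := abs_sub_cut_le (f v).im hε
  rw [two_mul]
  refine add_le_add (le_of_eq_of_le ?_ h1) (le_of_eq_of_le ?_ h2)
  · congr 1
    change (f v - (cutoff f 1 ε hε v - cutoff f (-1) ε hε v + Complex.I *
      (cutoff f (-Complex.I) ε hε v - cutoff f Complex.I ε hε v))).re = _
    simp [cutoff_apply]
  · congr 1
    change (f v - (cutoff f 1 ε hε v - cutoff f (-1) ε hε v + Complex.I *
      (cutoff f (-Complex.I) ε hε v - cutoff f Complex.I ε hε v))).im = _
    simp [cutoff_apply]

/-- The nonnegative functions with compact support in `R` generate the algebra of all functions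
which vanish at infinity and off `R`. -/
theorem topologicalClosure_adjoin_nonneg (R : Set Y) :
    ((NonUnitalStarAlgebra.adjoin ℂ {f : C₀(Y, ℂ) | HasCompactSupport f ∧ tsupport f ⊆ R ∧
      ∀ v, 0 ≤ f v}).topologicalClosure : Set C₀(Y, ℂ)) = {f | ∀ v ∉ R, f v = 0} := by
  apply Set.Subset.antisymm
  · refine closure_minimal (fun f hf => ?_) ?_
    · change f ∈ NonUnitalStarAlgebra.adjoin ℂ _ at hf
      change ∀ v ∉ R, f v = 0
      intro v hv
      induction hf using NonUnitalStarAlgebra.adjoin_induction with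
      | mem f hf => exact image_eq_zero_of_notMem_tsupport fun h => hv (hf.2.1 h)
      | add f g _ _ hf hg => rw [ZeroAtInftyContinuousMap.add_apply, hf, hg, add_zero]
      | zero => rfl
      | mul f g _ _ hf hg => rw [ZeroAtInftyContinuousMap.mul_apply, hf, zero_mul]
      | smul c f _ hf => rw [ZeroAtInftyContinuousMap.smul_apply, hf, smul_zero]
      | star f _ hf => rw [ZeroAtInftyContinuousMap.star_apply, hf, star_zero]
    · simp only [Set.ofPred_forall]
      exact isClosed_iInter fun v => isClosed_iInter fun _ =>
        isClosed_eq (ZeroAtInftyContinuousMap.continuous_eval_const v) continuous_const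
  · intro f hf
    refine Metric.mem_closure_iff.2 fun ε hε => ?_
    -- The four cutoffs at level `ε / 4` are supported in `{‖f‖ ≥ ε / 4}`, a compact subset of `R`,
    -- and approximate `f` within `2 · ε / 4 < ε`.
    have hε' : 0 < ε / 4 := by positivity
    have hmem : ∀ θ : ℂ, ‖θ‖ = 1 → cutoff f θ (ε / 4) hε'.le ∈ NonUnitalStarAlgebra.adjoin ℂ
        {f : C₀(Y, ℂ) | HasCompactSupport f ∧ tsupport f ⊆ R ∧ ∀ v, 0 ≤ f v} := by
      intro θ hθ
      have hsub := tsupport_cutoff_subset f hθ hε'.le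
      refine NonUnitalStarAlgebra.subset_adjoin ℂ _ ⟨?_, ?_, fun v => ?_⟩
      · exact (f.isCompact_norm_ge hε').of_isClosed_subset (isClosed_tsupport _) hsub
      · refine hsub.trans fun v hv => ?_
        by_contra hvR
        have hv' : ε / 4 ≤ ‖f v‖ := hv
        rw [hf v hvR, norm_zero] at hv'
        linarith
      · rw [cutoff_apply]
        exact_mod_cast le_max_right _ _
    refine ⟨_, add_mem (sub_mem (hmem 1 (by simp)) (hmem (-1) (by simp)))
      (SMulMemClass.smul_mem Complex.I
        (sub_mem (hmem (-Complex.I) (by simp)) (hmem Complex.I (by simp)))), ?_⟩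
    rw [dist_eq_norm]
    refine (norm_sub_cutoff_le f hε'.le).trans_lt ?_
    linarith

end VanishingOff

theorem CStarCorrespondence.IsCompactsHom.map_eq_sum {A X B : Type*} [NonUnitalCStarAlgebra A]
    [NormedAddCommGroup X] [NormedSpace ℂ X] [CompleteSpace X] [NonUnitalCStarAlgebra B]
    {C : CStarCorrespondence A X} {ψ : X →ₗ[ℂ] B} {Ψ : C.compacts →L[ℂ] B}
    (h : C.IsCompactsHom ψ Ψ) {J : Type*} {s : Finset J} {x y : J → X} {T : X →L[ℂ] X}
    (hT : T ∈ C.compacts) (hsum : T = ∑ j ∈ s, C.theta (x j) (y j)) :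
    Ψ ⟨T, hT⟩ = ∑ j ∈ s, ψ (x j) * star (ψ (y j)) := by
  have h1 : (⟨T, hT⟩ : C.compacts) =
      ∑ j ∈ s, ⟨C.theta (x j) (y j), C.theta_mem_compacts (x j) (y j)⟩ :=
    Subtype.ext (by
      change T = _
      rw [AddSubmonoidClass.coe_finsetSum]
      exact hsum)
  rw [h1, map_sum]
  exact Finset.sum_congr rfl fun j _ => h.map_theta _ _

/-! ### Compact operators on `X(E)` and the Katsura ideal -/

namespace TopologicalGraph

open scoped ComplexOrder

variable {E₀ : Type u} {E₁ : Type v} [TopologicalSpace E₀] [TopologicalSpace E₁]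
  [T2Space E₀] [T2Space E₁] (E : TopologicalGraph E₀ E₁)

theorem innerCc_apply_of_mem {x : C_c(E₁, ℂ)} (hx : E.IsSSection (Function.support x))
    (z : C_c(E₁, ℂ)) {e : E₁} (he : x e ≠ 0) : E.innerCc x z (E.s e) = star (x e) * z e := by
  rw [innerCc_apply, finsum_mem_inter_support_eq _ _ {e} ?_, finsum_mem_singleton]
  ext e'
  constructor
  · rintro ⟨h1, h2⟩
    have h3 : x e' ≠ 0 := fun h0 => h2 (by simp [h0])
    exact ⟨hx.injOn h3 he h1, h2⟩
  · rintro ⟨h1, h2⟩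
    exact ⟨congrArg E.s h1, h2⟩

/-- Since `√f_N` is supported in an `s`-section, only one edge of each fibre contributes to `⟨√f_N,
z⟩`. Thus `Θ_{√f_N, √f_N}` is multiplication by `f_N`, and these functions add up to `f ∘ r`. -/
theorem lact_eq_sum_theta {f : C₀(E₀, ℂ)} {𝒩 : Finset (Set E₁)} {F : Set E₁ → C_c(E₁, NNReal)}
    (hs : ∀ N ∈ 𝒩, E.IsSSection N) (hF : ∀ N ∈ 𝒩, Function.support (F N) ⊆ N)
    (hsum : ∀ e, ∑ N ∈ 𝒩, ((F N e : ℝ) : ℂ) = f (E.r e)) :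
    E.graphCorr.lact f =
      ∑ N ∈ 𝒩, E.graphCorr.theta (E.toCorr (sqrtCc (F N))) (E.toCorr (sqrtCc (F N))) := by
  refine completion_clm_ext fun z => ?_
  change E.graphCorr.lact f (E.toCorr ((PreCorr.of E).symm z)) =
    (∑ N ∈ 𝒩, E.graphCorr.theta (E.toCorr (sqrtCc (F N))) (E.toCorr (sqrtCc (F N))))
      (E.toCorr ((PreCorr.of E).symm z))
  generalize (PreCorr.of E).symm z = z
  simp only [sum_apply, CStarCorrespondence.theta_apply, E.corrInner_toCorr,
    E.corrLact_toCorr, E.corrRact_toCorr, ← map_sum]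
  refine E.toCorr_eq fun e => ?_
  rw [CompactlySupportedContinuousMap.sum_apply]
  change f (E.r e) * z e = ∑ N ∈ 𝒩, sqrtCc (F N) e * E.innerCc (sqrtCc (F N)) z (E.s e)
  rw [← hsum, Finset.sum_mul]
  refine Finset.sum_congr rfl fun N hN => ?_
  have hsub : Function.support (sqrtCc (F N)) ⊆ Function.support (F N) := fun e he h0 => he <| by
    change ((NNReal.sqrt (F N e) : ℝ) : ℂ) = 0
    rw [h0]; simp
  have hsq : ((F N e : ℝ) : ℂ) = sqrtCc (F N) e * star (sqrtCc (F N) e) := by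
    change _ = ((NNReal.sqrt (F N e) : ℝ) : ℂ) * star ((NNReal.sqrt (F N e) : ℝ) : ℂ)
    rw [Complex.star_def, Complex.conj_ofReal, ← Complex.ofReal_mul, ← NNReal.coe_mul,
      NNReal.mul_self_sqrt]
  by_cases h0 : sqrtCc (F N) e = 0
  · rw [hsq, h0, zero_mul, zero_mul, zero_mul]
  · rw [E.innerCc_apply_of_mem ((hs N hN).mono (hsub.trans (hF N hN))) z h0, hsq, mul_assoc]

theorem norm_apply_le (x : C_c(E₁, ℂ)) (e : E₁) : ‖x e‖ ≤ ‖E.toCorr x‖ := by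
  refine le_of_sq_le_sq ?_ (norm_nonneg _)
  rw [E.norm_toCorr_sq]
  have h1 := E.norm_sq_le_innerCc x e
  have h2 : (‖x e‖ ^ 2 : ℝ) ≤ (E.innerCc x x (E.s e)).re := by
    exact (Complex.le_def.1 h1).1
  exact h2.trans ((Complex.re_le_norm _).trans
    (BoundedContinuousFunction.norm_coe_le_norm (E.innerCc x x).toBCF (E.s e)))

/-- Evaluation at an edge, as a functional on `X(E)`. -/
def evalCorr (e : E₁) : E.CorrSpace →L[ℂ] ℂ :=
  extendToCompletion (P := E.PreCorr) (σ := RingHom.id ℂ)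
    { toFun := fun x => (PreCorr.of E).symm x e
      map_add' := fun _ _ => rfl
      map_smul' := fun _ _ => rfl }

theorem evalCorr_toCorr (e : E₁) (x : C_c(E₁, ℂ)) : E.evalCorr e (E.toCorr x) = x e :=
  extendToCompletion_coe (c := 1) (fun x => by
    rw [one_mul]
    exact (E.norm_apply_le ((PreCorr.of E).symm x) e).trans_eq
      (UniformSpace.Completion.norm_coe x)) (PreCorr.of E x)

theorem norm_evalCorr_le (e : E₁) (x : E.CorrSpace) : ‖E.evalCorr e x‖ ≤ ‖x‖ := by
  refine E.denseRange_toCorr.induction_on (p := fun x => ‖E.evalCorr e x‖ ≤ ‖x‖) x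
    (isClosed_le (by fun_prop) (by fun_prop)) fun x => ?_
  rw [evalCorr_toCorr]
  exact E.norm_apply_le x e

/-- Test vectors for reading off `f(r(e))` from `φ(f)`. Support in an `s`-section keeps the norm at
most `1`, because `⟨z, z⟩` then takes only the values `|z(e)|²` and `0`. -/
theorem exists_bump [LocallyCompactSpace E₁] (e : E₁) :
    ∃ z : C_c(E₁, ℂ), z e = 1 ∧ ‖E.toCorr z‖ ≤ 1 := by
  obtain ⟨U, hU, heU, hUs⟩ := E.exists_isSSection e
  obtain ⟨g, hg1, hg0, hgc, hgI⟩ := exists_continuous_one_zero_of_isCompact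
    (isCompact_singleton (x := e)) hU.isClosed_compl
    (Set.disjoint_left.2 fun e' he' => by rw [he']; exact not_not.2 heU)
  let z : C_c(E₁, ℂ) :=
    { toFun := fun e => (g e : ℂ)
      continuous_toFun := by fun_prop
      hasCompactSupport' := hgc.comp_left (g := Complex.ofReal) Complex.ofReal_zero }
  have hzn : ∀ e, ‖z e‖ ≤ 1 := fun e => by
    change ‖(g e : ℂ)‖ ≤ 1
    rw [Complex.norm_real, Real.norm_of_nonneg (hgI e).1]
    exact (hgI e).2
  have hzU : Function.support z ⊆ U := fun e he => by
    by_contra heU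
    refine he ?_
    change (g e : ℂ) = 0
    rw [hg0 heU]; simp
  have hat := E.isHat_innerCc (hUs.mono hzU)
  refine ⟨z, ?_, ?_⟩
  · change (g e : ℂ) = 1
    rw [hg1 rfl]; simp
  · refine le_of_sq_le_sq ?_ zero_le_one
    rw [E.norm_toCorr_sq, one_pow, ← ZeroAtInftyContinuousMap.norm_toBCF_eq_norm]
    refine (BoundedContinuousFunction.norm_le zero_le_one).2 fun v => ?_
    change ‖E.innerCc z z v‖ ≤ 1
    by_cases hv : v ∈ E.s '' Function.support z
    · obtain ⟨e, he, rfl⟩ := hv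
      rw [hat.1 e he, Complex.norm_real, Real.norm_of_nonneg (by positivity)]
      exact pow_le_one₀ (norm_nonneg _) (hzn e)
    · rw [hat.2 v hv, norm_zero]; exact zero_le_one

/-- The evaluations of a compact operator are small off a compact set. -/
theorem exists_isCompact_norm_evalCorr_le {T : E.CorrSpace →L[ℂ] E.CorrSpace}
    (hT : T ∈ E.graphCorr.compacts) {ε : ℝ} (hε : 0 < ε) :
    ∃ K : Set E₁, IsCompact K ∧ ∀ e ∉ K, ∀ z, ‖E.evalCorr e (T z)‖ ≤ ε * ‖z‖ := by
  obtain ⟨S, hS, hST⟩ := Metric.mem_closure_iff.1 hT (ε / 2) (by positivity)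
  have hspan : ∀ δ : ℝ, 0 < δ →
      ∃ K : Set E₁, IsCompact K ∧ ∀ e ∉ K, ∀ z, ‖E.evalCorr e (S z)‖ ≤ δ * ‖z‖ := by
    change S ∈ Submodule.span ℂ _ at hS
    clear hST
    induction hS using Submodule.span_induction with
    | mem S hS =>
      obtain ⟨x, y, rfl⟩ := hS
      intro δ hδ
      -- `c` bounds the effect on `Θ_{x,y}` of changing `x`. Replacing `x` by a nearby `x'` in
      -- `C_c(E₁)` costs at most `δ`, and `x' · g` vanishes off `supp x'`. The denominator `c + 1`
      -- avoids division by zero.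
      set c := ‖E.graphCorr.ract‖ * (‖E.graphCorr.inner‖ * ‖y‖) with hc
      have hc0 : 0 ≤ c := by positivity
      obtain ⟨x', hx'⟩ := Metric.denseRange_iff.1 E.denseRange_toCorr x (δ / (c + 1))
        (by positivity)
      rw [dist_eq_norm, lt_div_iff₀ (by positivity)] at hx'
      refine ⟨tsupport x', x'.hasCompactSupport', fun e he z => ?_⟩
      have h1 : E.graphCorr.theta x y z =
          E.graphCorr.ract (x - E.toCorr x') (E.graphCorr.inner y z) +
            E.toCorr (E.rmul x' (E.graphCorr.inner y z)) := by
        rw [map_sub, sub_apply, E.corrRact_toCorr, sub_add_cancel]; rfl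
      have h2 : E.rmul x' (E.graphCorr.inner y z) e = 0 := by
        change x' e * _ = 0
        rw [image_eq_zero_of_notMem_tsupport he, zero_mul]
      rw [h1, map_add, evalCorr_toCorr, h2, add_zero]
      calc ‖E.evalCorr e (E.graphCorr.ract (x - E.toCorr x') (E.graphCorr.inner y z))‖
          ≤ ‖E.graphCorr.ract (x - E.toCorr x') (E.graphCorr.inner y z)‖ := E.norm_evalCorr_le e _
        _ ≤ ‖E.graphCorr.ract‖ * ‖x - E.toCorr x'‖ * ‖E.graphCorr.inner y z‖ :=
            E.graphCorr.ract.le_opNorm₂ _ _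
        _ ≤ ‖E.graphCorr.ract‖ * ‖x - E.toCorr x'‖ * (‖E.graphCorr.inner‖ * ‖y‖ * ‖z‖) := by
            gcongr; exact E.graphCorr.inner.le_opNorm₂ _ _
        _ = ‖x - E.toCorr x'‖ * c * ‖z‖ := by rw [hc]; ring
        _ ≤ ‖x - E.toCorr x'‖ * (c + 1) * ‖z‖ := by gcongr; linarith
        _ ≤ δ * ‖z‖ := by gcongr
    | zero =>
      exact fun δ hδ => ⟨∅, isCompact_empty, fun e _ z => by
        rw [zero_apply, map_zero, norm_zero]; positivity⟩
    | add S T _ _ hS hT =>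
      intro δ hδ
      obtain ⟨K, hK, hKS⟩ := hS (δ / 2) (by positivity)
      obtain ⟨L, hL, hLT⟩ := hT (δ / 2) (by positivity)
      refine ⟨K ∪ L, hK.union hL, fun e he z => ?_⟩
      rw [Set.mem_union, not_or] at he
      rw [add_apply, map_add]
      refine (norm_add_le _ _).trans ((add_le_add (hKS e he.1 z) (hLT e he.2 z)).trans_eq ?_)
      ring
    | smul c S _ hS =>
      intro δ hδ
      obtain ⟨K, hK, hKS⟩ := hS (δ / (‖c‖ + 1)) (by positivity)
      refine ⟨K, hK, fun e he z => ?_⟩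
      rw [smul_apply, map_smul, norm_smul]
      calc ‖c‖ * ‖E.evalCorr e (S z)‖ ≤ (‖c‖ + 1) * (δ / (‖c‖ + 1) * ‖z‖) := by
            gcongr
            · linarith
            · exact hKS e he z
        _ = δ * ‖z‖ := by field_simp
  obtain ⟨K, hK, hKS⟩ := hspan (ε / 2) (by positivity)
  refine ⟨K, hK, fun e he z => ?_⟩
  have h1 : T z = (T - S) z + S z := by simp
  rw [dist_eq_norm] at hST
  rw [h1, map_add]
  calc ‖E.evalCorr e ((T - S) z) + E.evalCorr e (S z)‖
      ≤ ‖E.evalCorr e ((T - S) z)‖ + ‖E.evalCorr e (S z)‖ := norm_add_le _ _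
    _ ≤ ε / 2 * ‖z‖ + ε / 2 * ‖z‖ := by
        refine add_le_add ?_ (hKS e he z)
        exact (E.norm_evalCorr_le e _).trans (((T - S).le_opNorm z).trans (by gcongr))
    _ = ε * ‖z‖ := by ring

theorem evalCorr_lact_toCorr (e : E₁) (f : C₀(E₀, ℂ)) (z : C_c(E₁, ℂ)) :
    E.evalCorr e (E.graphCorr.lact f (E.toCorr z)) = f (E.r e) * z e := by
  rw [E.corrLact_toCorr, evalCorr_toCorr]; rfl

/-- Applying `φ(f)` to a bump at `e` and evaluating at `e` gives `f(r(e))`, which is at most `‖f v‖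
/ 4` in norm off a compact `K`. So `K` contains the preimage of the neighbourhood `{‖f‖ ≥ ‖f v‖ /
2}` of `v`. -/
theorem mem_finSet_of_lact_mem_compacts [LocallyCompactSpace E₁] {f : C₀(E₀, ℂ)}
    (hf : E.graphCorr.lact f ∈ E.graphCorr.compacts) {v : E₀} (hv : f v ≠ 0) : v ∈ E.finSet := by
  have hv' : 0 < ‖f v‖ := norm_pos_iff.2 hv
  obtain ⟨K, hK, hKf⟩ := E.exists_isCompact_norm_evalCorr_le hf (ε := ‖f v‖ / 4) (by positivity)
  have hclosed : IsClosed {w | ‖f v‖ / 2 ≤ ‖f w‖} :=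
    isClosed_le continuous_const f.continuous.norm
  refine ⟨{w | ‖f v‖ / 2 ≤ ‖f w‖}, ?_, ?_⟩
  · refine Filter.mem_of_superset ((isOpen_lt continuous_const f.continuous.norm).mem_nhds
      (show ‖f v‖ / 2 < ‖f v‖ by linarith)) fun w hw => ?_
    have hw' : ‖f v‖ / 2 < ‖f w‖ := hw
    exact hw'.le
  · refine hK.of_isClosed_subset (hclosed.preimage E.continuous_r) fun e he => ?_
    by_contra heK
    obtain ⟨z, hz1, hzn⟩ := E.exists_bump e
    have h1 := hKf e heK (E.toCorr z)
    rw [evalCorr_lact_toCorr, hz1, mul_one] at h1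
    have h2 : ‖f v‖ / 2 ≤ ‖f (E.r e)‖ := he
    have h3 : ‖f v‖ / 4 * ‖E.toCorr z‖ ≤ ‖f v‖ / 4 * 1 := by gcongr
    linarith

theorem lact_eq_zero_iff [LocallyCompactSpace E₁] {f : C₀(E₀, ℂ)} :
    E.graphCorr.lact f = 0 ↔ ∀ e, f (E.r e) = 0 := by
  constructor
  · intro h e
    obtain ⟨z, hz1, -⟩ := E.exists_bump e
    have := E.evalCorr_lact_toCorr e f z
    rw [h, hz1, mul_one, zero_apply, map_zero] at this
    exact this.symm
  · intro h
    refine completion_clm_ext fun z => ?_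
    refine (E.corrLact_toCorr f ((PreCorr.of E).symm z)).trans ?_
    rw [zero_apply, ← map_zero E.toCorr]
    exact E.toCorr_eq fun e => by
      change f (E.r e) * _ = 0
      rw [h, zero_mul]

/-- Compactness of `φ(f)` puts `v` in `E⁰_fin`. If `v` were also in the closure of `E⁰_sce`, then
`f` would be nonzero at some source `w`, and a bump at `w` vanishing on `r(E¹)` would be an element
of `ker φ` not annihilated by `f`. -/
theorem eq_zero_of_mem_katsuraIdeal [LocallyCompactSpace E₀] [LocallyCompactSpace E₁]
    {f : C₀(E₀, ℂ)} (hf : f ∈ E.graphCorr.katsuraIdeal) {v : E₀} (hv : v ∉ E.rgSet) : f v = 0 := by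
  by_contra hfv
  refine hv ⟨E.mem_finSet_of_lact_mem_compacts hf.1 hfv, fun hcl => ?_⟩
  obtain ⟨w, hw, hws⟩ := mem_closure_iff.1 hcl {w | f w ≠ 0}
    (isOpen_ne_fun f.continuous continuous_const) hfv
  obtain ⟨g, hg1, hg0, hgc, -⟩ := exists_continuous_one_zero_of_isCompact
    (isCompact_singleton (x := w)) (isClosed_closure (s := Set.range E.r))
    (Set.disjoint_left.2 fun e he => by rw [he]; exact hws)
  let b' : C_c(E₀, ℂ) :=
    { toFun := fun e => (g e : ℂ)
      continuous_toFun := by fun_prop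
      hasCompactSupport' := hgc.comp_left (g := Complex.ofReal) Complex.ofReal_zero }
  let b : C₀(E₀, ℂ) := b'
  have hb : E.graphCorr.lact b = 0 := E.lact_eq_zero_iff.2 fun e => by
    change (g (E.r e) : ℂ) = 0
    rw [hg0 (subset_closure ⟨e, rfl⟩)]; simp
  have h1 : (f * b) w = 0 := by rw [hf.2 b hb]; rfl
  have h2 : b w = 1 := by
    change (g w : ℂ) = 1
    rw [hg1 rfl]; simp
  rw [ZeroAtInftyContinuousMap.mul_apply, h2, mul_one] at h1
  exact hw h1

end TopologicalGraph

/-! ### Covariance -/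

namespace TopologicalGraph

open scoped ComplexOrder

variable {E₀ : Type u} {E₁ : Type v} [TopologicalSpace E₀] [TopologicalSpace E₁]
  [T2Space E₀] [T2Space E₁] (E : TopologicalGraph E₀ E₁)

theorem isCompact_preimage_of_subset_finSet {K : Set E₀} (hK : IsCompact K) (h : K ⊆ E.finSet) :
    IsCompact (E.r ⁻¹' K) := by
  obtain ⟨L, hL, hKL⟩ : ∃ L : Set E₁, IsCompact L ∧ E.r ⁻¹' K ⊆ L := by
    -- Containment in a compact set, unlike compactness of the preimage itself, passes to subsets
    -- and is therefore suited to the induction.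
    refine hK.induction_on (p := fun K => ∃ L : Set E₁, IsCompact L ∧ E.r ⁻¹' K ⊆ L) ?_ ?_ ?_ ?_
    · exact ⟨∅, isCompact_empty, by simp⟩
    · rintro s t hst ⟨L, hL, htL⟩
      exact ⟨L, hL, (Set.preimage_mono hst).trans htL⟩
    · rintro s t ⟨L, hL, hsL⟩ ⟨M, hM, htM⟩
      exact ⟨L ∪ M, hL.union hM, Set.union_subset_union hsL htM⟩
    · intro v hv
      obtain ⟨N, hN, hNc⟩ := h hv
      exact ⟨N, mem_nhdsWithin_of_mem_nhds hN, _, hNc, subset_rfl⟩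
  exact hL.of_isClosed_subset (hK.isClosed.preimage E.continuous_r) hKL

/-- A nonnegative function with compact support in `E⁰_fin` splits, when composed with the range
map, into pieces supported in `s`-sections. -/
theorem exists_decomposition [LocallyCompactSpace E₁] {f : C₀(E₀, ℂ)} (hfc : HasCompactSupport f)
    (hf : tsupport f ⊆ E.finSet) (hf0 : ∀ v, 0 ≤ f v) :
    ∃ (𝒩 : Finset (Set E₁)) (F : Set E₁ → C_c(E₁, NNReal)),
      (∀ N ∈ 𝒩, IsOpen N ∧ E.IsSSection N) ∧
      E.r ⁻¹' tsupport f ⊆ ⋃ N ∈ 𝒩, N ∧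
      (∀ N ∈ 𝒩, Function.support (F N) ⊆ N ∩ E.r ⁻¹' tsupport f) ∧
      ∀ e, ∑ N ∈ 𝒩, ((F N e : ℝ) : ℂ) = f (E.r e) := by
  classical
  have hK : IsCompact (E.r ⁻¹' tsupport f) := E.isCompact_preimage_of_subset_finSet hfc hf
  choose U hU heU hUs using E.exists_isSSection
  obtain ⟨t, ht⟩ := hK.elim_finite_subcover U hU fun e _ => Set.mem_iUnion.2 ⟨e, heU e⟩
  let 𝒩 : Finset (Set E₁) := t.image U
  have h𝒩 : ∀ N ∈ 𝒩, IsOpen N ∧ E.IsSSection N := fun N hN => by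
    obtain ⟨e, -, rfl⟩ := Finset.mem_image.1 hN
    exact ⟨hU e, hUs e⟩
  have hcover : E.r ⁻¹' tsupport f ⊆ ⋃ N ∈ 𝒩, N := fun e he => by
    obtain ⟨e', he', hee'⟩ := Set.mem_iUnion₂.1 (ht he)
    exact Set.mem_iUnion₂.2 ⟨U e', Finset.mem_image_of_mem U he', hee'⟩
  obtain ⟨g, hg, hg1, hgI, hgc⟩ := exists_continuous_sum_one_of_isOpen_isCompact
    (s := fun i : Fin 𝒩.card => (𝒩.equivFin.symm i : Set E₁))
    (fun i => (h𝒩 _ (𝒩.equivFin.symm i).2).1) hK fun e he => by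
      obtain ⟨N, hN, heN⟩ := Set.mem_iUnion₂.1 (hcover he)
      exact Set.mem_iUnion.2 ⟨𝒩.equivFin ⟨N, hN⟩, by simpa using heN⟩
  -- The pieces are `g_i · (f ∘ r)`: the factor `g_i` confines the support to a section, the factor
  -- `f ∘ r` to `r⁻¹(supp f)`.
  let G : Fin 𝒩.card → C_c(E₁, NNReal) := fun i =>
    { toFun := fun e => Real.toNNReal (g i e * (f (E.r e)).re)
      continuous_toFun := by
        have hfr : Continuous fun e => f (E.r e) := f.continuous.comp E.continuous_r
        exact continuous_real_toNNReal.comp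
          ((g i).continuous.mul (Complex.continuous_re.comp hfr))
      hasCompactSupport' := (hgc i).mul_right.comp_left (g := Real.toNNReal) Real.toNNReal_zero }
  let F : Set E₁ → C_c(E₁, NNReal) := fun N => if h : N ∈ 𝒩 then G (𝒩.equivFin ⟨N, h⟩) else 0
  have hF : ∀ N : 𝒩, F N = G (𝒩.equivFin N) := fun N => dif_pos N.2
  have hGapply : ∀ i e, ((G i e : ℝ) : ℂ) = (g i e : ℂ) * f (E.r e) := fun i e => by
    have h0 := Complex.nonneg_iff.1 (hf0 (E.r e))
    change ((Real.toNNReal (g i e * (f (E.r e)).re) : ℝ) : ℂ) = _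
    rw [Real.coe_toNNReal _ (mul_nonneg (hgI i e).1 h0.1), Complex.ofReal_mul]
    congr 1
    exact Complex.ext rfl h0.2
  refine ⟨𝒩, F, h𝒩, hcover, fun N hN e he => ?_, fun e => ?_⟩
  · rw [hF ⟨N, hN⟩] at he
    have he' : ((G (𝒩.equivFin ⟨N, hN⟩) e : ℝ) : ℂ) ≠ 0 := by
      simpa using he
    rw [hGapply] at he'
    refine ⟨?_, subset_tsupport _ (right_ne_zero_of_mul he')⟩
    have h1 : e ∈ tsupport (g (𝒩.equivFin ⟨N, hN⟩)) :=
      subset_tsupport _ (by simpa using left_ne_zero_of_mul he')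
    simpa using hg _ h1
  · rw [← Finset.sum_coe_sort 𝒩 (fun N => ((F N e : ℝ) : ℂ)),
      ← Equiv.sum_comp 𝒩.equivFin.symm]
    simp only [hF, Equiv.apply_symm_apply, hGapply]
    rw [← Finset.sum_mul, ← Complex.ofReal_sum]
    by_cases he : E.r e ∈ tsupport f
    · have h1 : ∑ i, g i e = 1 := by simpa using hg1 he
      rw [h1, Complex.ofReal_one, one_mul]
    · rw [image_eq_zero_of_notMem_tsupport he, mul_zero]

/-- The decomposition gives compactness. For orthogonality to `ker φ`, the support of `f` avoids
`E⁰_sce`, hence lies in the closure of `r(E¹)`, where every element of `ker φ` vanishes. -/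
theorem mem_katsuraIdeal_of_decomposition [LocallyCompactSpace E₁] {f : C₀(E₀, ℂ)}
    (hf : tsupport f ⊆ E.rgSet) {𝒩 : Finset (Set E₁)} {F : Set E₁ → C_c(E₁, NNReal)}
    (hsum : E.graphCorr.lact f =
      ∑ N ∈ 𝒩, E.graphCorr.theta (E.toCorr (sqrtCc (F N))) (E.toCorr (sqrtCc (F N)))) :
    f ∈ E.graphCorr.katsuraIdeal := by
  refine ⟨?_, fun b hb => ?_⟩
  · rw [hsum]
    exact Submodule.sum_mem _ fun N _ => E.graphCorr.theta_mem_compacts _ _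
  · ext v
    rw [ZeroAtInftyContinuousMap.mul_apply, ZeroAtInftyContinuousMap.zero_apply, mul_eq_zero]
    by_cases hv : v ∈ tsupport f
    · refine Or.inr ?_
      have h1 : v ∈ closure (Set.range E.r) := by
        by_contra h
        exact (hf hv).2 (subset_closure h)
      have hcl : IsClosed {w | b w = 0} := isClosed_eq b.continuous continuous_const
      refine closure_minimal ?_ hcl h1
      rintro _ ⟨e, rfl⟩
      exact E.lact_eq_zero_iff.1 hb e
    · exact Or.inl (image_eq_zero_of_notMem_tsupport hv)

section Representations

variable {E} {B : Type*} [NonUnitalCStarAlgebra B] {π : C₀(E₀, ℂ) →⋆ₙₐ[ℂ] B}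

/-- A covariant representation of `X(E)` restricts to a covariant representation of `E`. -/
theorem isCovariantRep_comp_toCorr [LocallyCompactSpace E₁] {ψ : E.CorrSpace →ₗ[ℂ] B}
    (h : E.graphCorr.IsCovariantRep ψ π) : E.IsCovariantRep (ψ ∘ₗ E.toCorr) π := by
  -- The generating set is taken to be all nonnegative functions in `C_c(E⁰_rg)`.
  refine ⟨isToeplitzRep_comp_toCorr h.toIsToeplitzRep, _, fun f hf => hf,
    topologicalClosure_adjoin_nonneg E.rgSet, fun f ⟨hfc, hfs, hf0⟩ => ?_⟩
  obtain ⟨𝒩, F, h𝒩, hcover, hF, hsum⟩ :=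
    E.exists_decomposition hfc (hfs.trans Set.sdiff_subset) hf0
  refine ⟨𝒩, F, h𝒩, hcover, hF, hsum, ?_⟩
  obtain ⟨Ψ, hΨ, hΨπ⟩ := h.covariant
  have hθ := E.lact_eq_sum_theta (fun N hN => (h𝒩 N hN).2)
    (fun N hN => (hF N hN).trans Set.inter_subset_left) hsum
  have hmem := E.mem_katsuraIdeal_of_decomposition hfs hθ
  rw [← hΨπ f hmem]
  exact hΨ.map_eq_sum hmem.1 hθ

theorem continuous_lact : Continuous E.graphCorr.lact := by
  refine AddMonoidHomClass.continuous_of_bound E.graphCorr.lact 1 fun f => ?_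
  rw [one_mul]
  refine ContinuousLinearMap.opNorm_le_bound _ (norm_nonneg f) fun x => ?_
  refine E.denseRange_toCorr.induction_on
    (p := fun x => ‖E.graphCorr.lact f x‖ ≤ ‖f‖ * ‖x‖) x
    (isClosed_le (by fun_prop) (by fun_prop)) fun x => ?_
  rw [E.corrLact_toCorr]
  have h := E.norm_lmul_le f (PreCorr.of E x)
  rw [← UniformSpace.Completion.norm_coe, ← UniformSpace.Completion.norm_coe (PreCorr.of E x)] at h
  exact h

/-- A covariant representation of `E` extends to a covariant representation of `X(E)`. -/
theorem IsCovariantRep.exists_extension [LocallyCompactSpace E₀] [LocallyCompactSpace E₁]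
    {ψ : C_c(E₁, ℂ) →ₗ[ℂ] B} (h : E.IsCovariantRep ψ π) :
    ∃ ψ' : E.CorrSpace →ₗ[ℂ] B, ψ' ∘ₗ E.toCorr = ψ ∧ E.graphCorr.IsCovariantRep ψ' π := by
  obtain ⟨ψ', rfl, hψ'⟩ := h.toIsToeplitzRep.exists_extension
  obtain ⟨Ψ, hΨ⟩ := hψ'.exists_isCompactsHom
  obtain ⟨𝒢, h𝒢, hgen, hcov⟩ := h.covariant
  have hπ : Continuous π := π.continuous_of_cstar
  -- `T` will be shown to be a closed algebra containing `𝒢`; it then contains `C₀(E⁰_rg)`, and with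
  -- it the Katsura ideal.
  let T : Set C₀(E₀, ℂ) :=
    {f | ∃ hf : E.graphCorr.lact f ∈ E.graphCorr.compacts, Ψ ⟨_, hf⟩ = π f}
  -- `Ψ` is defined only on `𝒦(X)`, so the equation is closed relative to `φ⁻¹(𝒦(X))`, which is
  -- itself closed.
  have hTc : IsClosed T := by
    let M : Set C₀(E₀, ℂ) := {f | E.graphCorr.lact f ∈ E.graphCorr.compacts}
    have hM : IsClosed M :=
      (Submodule.isClosed_topologicalClosure _).preimage E.continuous_lact
    have hTM : T = Subtype.val '' {f : M | Ψ ⟨E.graphCorr.lact f.1, f.2⟩ = π f.1} := by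
      ext f
      constructor
      · rintro ⟨hf, hf'⟩
        exact ⟨⟨f, hf⟩, hf', rfl⟩
      · rintro ⟨⟨f, hf⟩, hf', rfl⟩
        exact ⟨hf, hf'⟩
    rw [hTM]
    refine hM.isClosedEmbedding_subtypeVal.isClosedMap _ (isClosed_eq ?_ ?_)
    · exact Ψ.continuous.comp ((E.continuous_lact.comp continuous_subtype_val).subtype_mk _)
    · exact hπ.comp continuous_subtype_val
  have hadd : ∀ f ∈ T, ∀ g ∈ T, f + g ∈ T := by
    rintro f ⟨hf, hf'⟩ g ⟨hg, hg'⟩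
    have hfg : E.graphCorr.lact (f + g) = E.graphCorr.lact f + E.graphCorr.lact g := map_add _ _ _
    refine ⟨hfg ▸ add_mem hf hg, ?_⟩
    rw [map_add π, ← hf', ← hg']
    exact (congrArg Ψ (Subtype.ext hfg)).trans (map_add Ψ ⟨_, hf⟩ ⟨_, hg⟩)
  have hsmul : ∀ (c : ℂ), ∀ f ∈ T, c • f ∈ T := by
    rintro c f ⟨hf, hf'⟩
    have hcf : E.graphCorr.lact (c • f) = c • E.graphCorr.lact f := map_smul _ _ _
    refine ⟨hcf ▸ Submodule.smul_mem _ c hf, ?_⟩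
    rw [map_smul π, ← hf']
    exact (congrArg Ψ (Subtype.ext hcf)).trans (map_smul Ψ c ⟨_, hf⟩)
  have hmul : ∀ f ∈ T, ∀ g ∈ T, f * g ∈ T := by
    rintro f ⟨hf, hf'⟩ g ⟨hg, hg'⟩
    have hfg : E.graphCorr.lact (f * g) = E.graphCorr.lact f * E.graphCorr.lact g := map_mul _ _ _
    refine ⟨hfg ▸ CStarCorrespondence.mul_mem_compacts hf hg, ?_⟩
    rw [map_mul π, ← hf', ← hg']
    exact hΨ.map_mul ⟨_, hf⟩ ⟨_, hg⟩ _ hfg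
  have hmem : ∀ f ∈ 𝒢, f ∈ T := by
    intro f hf
    obtain ⟨𝒩, F, h𝒩, -, hF, hsum, hπf⟩ := hcov f hf
    have hθ := E.lact_eq_sum_theta (fun N hN => (h𝒩 N hN).2)
      (fun N hN => (hF N hN).trans Set.inter_subset_left) hsum
    have hk := E.mem_katsuraIdeal_of_decomposition (h𝒢 f hf).2.1 hθ
    exact ⟨hk.1, (hΨ.map_eq_sum hk.1 hθ).trans hπf.symm⟩
  -- Carrying `star f` along avoids proving `T` closed under adjoints; the generators are
  -- self-adjoint because they are nonnegative.
  have hadj : ∀ f ∈ NonUnitalStarAlgebra.adjoin ℂ 𝒢, f ∈ T ∧ star f ∈ T := by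
    intro f hf
    induction hf using NonUnitalStarAlgebra.adjoin_induction with
    | mem f hf =>
      have hstar : star f = f := by
        ext v
        rw [ZeroAtInftyContinuousMap.star_apply]
        exact (IsSelfAdjoint.of_nonneg ((h𝒢 f hf).2.2 v)).star_eq
      rw [hstar]
      exact ⟨hmem f hf, hmem f hf⟩
    | add f g _ _ hf hg =>
      rw [star_add]
      exact ⟨hadd _ hf.1 _ hg.1, hadd _ hf.2 _ hg.2⟩
    | zero =>
      have h0 : (0 : C₀(E₀, ℂ)) ∈ T := by
        have h1 : E.graphCorr.lact 0 = 0 := map_zero _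
        refine ⟨h1 ▸ zero_mem _, ?_⟩
        rw [map_zero π, ← map_zero Ψ]
        exact congrArg Ψ (Subtype.ext h1)
      rw [star_zero]
      exact ⟨h0, h0⟩
    | mul f g _ _ hf hg =>
      rw [StarMul.star_mul]
      exact ⟨hmul _ hf.1 _ hg.1, hmul _ hg.2 _ hf.2⟩
    | smul c f _ hf =>
      rw [star_smul]
      exact ⟨hsmul c _ hf.1, hsmul _ _ hf.2⟩
    | star f _ hf => exact ⟨hf.2, (star_star f).symm ▸ hf.1⟩
  refine ⟨ψ', rfl, hψ', Ψ, hΨ, fun f hf => ?_⟩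
  have hfT : f ∈ T := by
    have hfg : f ∈ ((NonUnitalStarAlgebra.adjoin ℂ 𝒢).topologicalClosure : Set C₀(E₀, ℂ)) := by
      rw [hgen]
      exact fun v hv => E.eq_zero_of_mem_katsuraIdeal hf hv
    exact closure_minimal (fun g hg => (hadj g hg).1) hTc hfg
  exact hfT.2

end Representations

end TopologicalGraph

/-! ### The main theorem -/

theorem generatedCStarAlgebra_le {X A B : Type*} [NonUnitalCStarAlgebra B] {ψ : X → B} {π : A → B}
    {S : NonUnitalStarSubalgebra ℂ B} (hS : IsClosed (S : Set B)) (hψ : ∀ x, ψ x ∈ S)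
    (hπ : ∀ a, π a ∈ S) : generatedCStarAlgebra ψ π ≤ S := by
  refine NonUnitalStarSubalgebra.topologicalClosure_minimal _ (NonUnitalStarAlgebra.adjoin_le ?_) hS
  rintro _ (⟨x, rfl⟩ | ⟨a, rfl⟩)
  · exact hψ x
  · exact hπ a

theorem NonUnitalStarAlgHom.eqOn_generatedCStarAlgebra {X A B D : Type*} [NonUnitalCStarAlgebra B]
    [NonUnitalCStarAlgebra D] {ψ : X → B} {π : A → B} {φ χ : B →⋆ₙₐ[ℂ] D}
    (hψ : ∀ x, φ (ψ x) = χ (ψ x)) (hπ : ∀ a, φ (π a) = χ (π a)) {b : B}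
    (hb : b ∈ generatedCStarAlgebra ψ π) : φ b = χ b :=
  generatedCStarAlgebra_le (S := NonUnitalStarAlgHom.equalizer φ χ)
    (isClosed_eq φ.continuous_of_cstar χ.continuous_of_cstar) hψ hπ hb

theorem generatedCStarAlgebra_comp_dense {X Y A B : Type*} [TopologicalSpace X]
    [NonUnitalCStarAlgebra B] {ψ : X → B} {π : A → B} {ι : Y → X} (hι : DenseRange ι)
    (hψ : Continuous ψ) : generatedCStarAlgebra (ψ ∘ ι) π = generatedCStarAlgebra ψ π := by
  refine le_antisymm (generatedCStarAlgebra_le (isClosed_generatedCStarAlgebra _ _)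
    (fun y => subset_generatedCStarAlgebra ψ π (Or.inl ⟨ι y, rfl⟩))
    fun a => subset_generatedCStarAlgebra ψ π (Or.inr ⟨a, rfl⟩))
    (generatedCStarAlgebra_le (isClosed_generatedCStarAlgebra _ _) (fun x => ?_)
    fun a => subset_generatedCStarAlgebra (ψ ∘ ι) π (Or.inr ⟨a, rfl⟩))
  exact hι.induction_on (p := fun x => ψ x ∈ generatedCStarAlgebra (ψ ∘ ι) π) x
    ((isClosed_generatedCStarAlgebra _ _).preimage hψ)
    fun y => subset_generatedCStarAlgebra (ψ ∘ ι) π (Or.inl ⟨y, rfl⟩)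

/-- Two pairs of maps which factor through each other generate isomorphic C⋆-algebras. -/
theorem nonempty_starAlgEquiv_generatedCStarAlgebra {X A B O : Type*} [NonUnitalCStarAlgebra B]
    [NonUnitalCStarAlgebra O] {ψ : X → B} {π : A → B} {j : X → O} {k : A → O}
    (hjk : generatedCStarAlgebra j k = ⊤) {φ : B →⋆ₙₐ[ℂ] O} {χ : O →⋆ₙₐ[ℂ] B}
    (hφψ : ∀ x, φ (ψ x) = j x) (hφπ : ∀ a, φ (π a) = k a) (hχj : ∀ x, χ (j x) = ψ x)
    (hχk : ∀ a, χ (k a) = π a) : Nonempty (generatedCStarAlgebra ψ π ≃⋆ₐ[ℂ] O) := by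
  let S := generatedCStarAlgebra ψ π
  have hφχ : ∀ o, φ (χ o) = o := fun o =>
    NonUnitalStarAlgHom.eqOn_generatedCStarAlgebra (ψ := j) (π := k) (φ := φ.comp χ)
      (χ := NonUnitalStarAlgHom.id ℂ O) (fun x => (congrArg φ (hχj x)).trans (hφψ x))
      (fun a => (congrArg φ (hχk a)).trans (hφπ a)) (hjk ▸ NonUnitalStarAlgebra.mem_top)
  -- Only on `S`: nothing forces `ψ` and `π` to generate all of `B`.
  have hχφ : ∀ b ∈ S, χ (φ b) = b := fun b hb =>
    NonUnitalStarAlgHom.eqOn_generatedCStarAlgebra (ψ := ψ) (π := π) (φ := χ.comp φ)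
      (χ := NonUnitalStarAlgHom.id ℂ B) (fun x => (congrArg χ (hφψ x)).trans (hχj x))
      (fun a => (congrArg χ (hφπ a)).trans (hχk a)) hb
  have hχS : ∀ o, χ o ∈ S := fun o => by
    have hle : generatedCStarAlgebra j k ≤ S.comap χ :=
      generatedCStarAlgebra_le
        ((isClosed_generatedCStarAlgebra ψ π).preimage χ.continuous_of_cstar)
        (fun x => by
          change χ (j x) ∈ S
          rw [hχj]
          exact subset_generatedCStarAlgebra ψ π (Or.inl ⟨x, rfl⟩))
        (fun a => by
          change χ (k a) ∈ S
          rw [hχk]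
          exact subset_generatedCStarAlgebra ψ π (Or.inr ⟨a, rfl⟩))
    exact hle (hjk ▸ NonUnitalStarAlgebra.mem_top)
  exact ⟨StarAlgEquiv.ofBijective (φ.comp (NonUnitalStarSubalgebraClass.subtype S))
    ⟨fun b c hbc => Subtype.ext (by
      rw [← hχφ b b.2, ← hχφ c c.2]
      exact congrArg χ hbc), fun o => ⟨⟨χ o, hχS o⟩, hφχ o⟩⟩⟩

theorem mainTheorem1 {E₀ : Type u} {E₁ : Type v} [TopologicalSpace E₀] [TopologicalSpace E₁]
    [LocallyCompactSpace E₀] [T2Space E₀] [LocallyCompactSpace E₁] [T2Space E₁]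
    (E : TopologicalGraph E₀ E₁) :
    -- the C⋆-algebra `𝒪(E) = 𝒪_{X(E)}` exists,
    (∃ (O : Type (max u v w)) (_ : NonUnitalCStarAlgebra O) (jX : E.CorrSpace →ₗ[ℂ] O)
      (jA : C₀(E₀, ℂ) →⋆ₙₐ[ℂ] O), E.graphCorr.IsCuntzPimsnerAlgebra jX jA) ∧
    -- and whenever `O` is `𝒪(E)`, with canonical representation `(jX, jA)` of `X(E)`,
    ∀ (O : Type (max u v w)) [NonUnitalCStarAlgebra O] (jX : E.CorrSpace →ₗ[ℂ] O)
      (jA : C₀(E₀, ℂ) →⋆ₙₐ[ℂ] O), E.graphCorr.IsCuntzPimsnerAlgebra jX jA →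
      -- the pair `(jX|_{C_c(E₁)}, jA)` is a universal covariant Toeplitz representation of `E`
      -- which generates `O`,
      (E.IsUniversalCovariantRep (jX ∘ₗ E.toCorr) jA ∧
        generatedCStarAlgebra (jX ∘ₗ E.toCorr) jA = ⊤) ∧
      -- and the C⋆-algebra generated by any universal covariant Toeplitz representation of `E`
      -- is isomorphic to `O`
      ∀ (B : Type (max u v w)) [NonUnitalCStarAlgebra B] (ψ : C_c(E₁, ℂ) →ₗ[ℂ] B)
        (π : C₀(E₀, ℂ) →⋆ₙₐ[ℂ] B), E.IsUniversalCovariantRep ψ π →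
        Nonempty (generatedCStarAlgebra ψ π ≃⋆ₐ[ℂ] O) := by
  refine ⟨E.graphCorr.exists_isCuntzPimsnerAlgebra, fun O _ jX jA h => ?_⟩
  have huniv : E.IsUniversalCovariantRep (jX ∘ₗ E.toCorr) jA := by
    refine ⟨TopologicalGraph.isCovariantRep_comp_toCorr h.toIsCovariantRep,
      fun D _ ψ' π' h' => ?_⟩
    obtain ⟨ψ, rfl, hψ⟩ := h'.exists_extension
    obtain ⟨φ, hφψ, hφπ⟩ := h.universal D ψ π' hψ
    exact ⟨φ, fun x => hφψ _, hφπ⟩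
  have hgen : generatedCStarAlgebra (jX ∘ₗ E.toCorr) jA = ⊤ := by
    rw [← h.generates]
    exact generatedCStarAlgebra_comp_dense E.denseRange_toCorr
      (AddMonoidHomClass.continuous_of_bound jX 1 fun x => by simpa using h.norm_map_le x)
  refine ⟨⟨huniv, hgen⟩, fun B _ ψ π hψπ => ?_⟩
  -- Each universal representation is mapped to the other. Universality asks only for existence of
  -- these maps; their composites are determined by their values on generators.
  obtain ⟨φ, hφψ, hφπ⟩ := hψπ.universal O _ jA huniv.toIsCovariantRep
  obtain ⟨χ, hχψ, hχπ⟩ := huniv.universal B ψ π hψπ.toIsCovariantRep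
  exact nonempty_starAlgEquiv_generatedCStarAlgebra hgen hφψ hφπ hχψ hχπ

end
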